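/- Let $N\ge 0$ be an integer, $T>0$, and let $\phi=\phi(\mathbf x,\xi):\mathbb R^N\times\mathbb R^N\to\mathbb R$ be differentiable. A field $\mathbf u:[0,T]\times\mathbb R^N\to\mathbb R^N$ is called feasible if it is measurable, there is $L$ such that $\mathbf u(t,\cdot)$ is $L$-Lipschitz for every $t\in[0,T]$, and $\mathbf u(\cdot,0)$ is bounded on $[0,T]$. For such $\mathbf u$ and $\mathbf x_0\in\mathbb R^N$, let $\mathbf x$ be the absolutely continuous integral curve, $\mathbf x'(t)=\mathbf u(t,\mathbf x(t))$ for a.e. $t\in[0,T]$, $\mathbf x(0)=\mathbf x_0$, and let its cost be $\int_0^T\phi(\mathbf x(t),\mathbf x'(t))\,dt$. A feasible field is optimal for the variational problem in feedback form if, for every $\mathbf x_0\in\mathbb R^N$, its cost is at most the cost of any other feasible field with the same $\mathbf x_0$. Let $\mathbf u$ be optimal, and let $\mathbf p:[0,T]\times\mathbb R^N\to\mathbb R^N$ be a solution of the linear transport system $$\mathbf p_t+\nabla\mathbf p\,\mathbf u+\mathbf p\,\nabla\mathbf u=\nabla_{\mathbf x}[\phi(\mathbf x,\mathbf u(t,\mathbf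 x))]\quad\text{in }[0,T]\times\mathbb R^N,\qquad \mathbf p(T,\cdot)=0,$$ that is, $\mathbf p$ is locally Lipschitz, $\mathbf p(T,\mathbf x)=0$ for all $\mathbf x$, and the equation holds almost everywhere (here $\nabla$ is the derivative in the space variable and $\mathbf p\,\nabla\mathbf u=(\nabla\mathbf u)^{\mathsf T}\mathbf p$). Then $\mathbf p\equiv\phi_\xi(\mathbf x,\mathbf u(t,\mathbf x))$: for almost every $t\in[0,T]$, $$\mathbf p(t,\mathbf x)=\phi_\xi(\mathbf x,\mathbf u(t,\mathbf x))\quad\text{for all }\mathbf x\in\mathbb R^N,$$ and if $\mathbf u$ is continuous on $[0,T]\times\mathbb R^N$, this holds for all $(t,\mathbf x)\in[0,T]\times\mathbb R^N$. -/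

import Mathlib

open Set MeasureTheory Function
open scoped NNReal

/-- A feasible field `u : [0, T] × ℝᴺ → ℝᴺ`: measurable, and, uniformly in `t ∈ [0, T]`, Lipschitz
in space and bounded at the origin (so of linear growth).  Values outside `[0, T]` are irrelevant. -/
structure IsFeasibleField {N : ℕ} (T : ℝ)
    (u : ℝ → EuclideanSpace ℝ (Fin N) → EuclideanSpace ℝ (Fin N)) : Prop where
  measurable : Measurable (uncurry u)
  lipschitz : ∃ L : ℝ≥0, ∀ t ∈ Icc 0 T, LipschitzWith L (u t)
  bounded_zero : ∃ C : ℝ, ∀ t ∈ Icc 0 T, ‖u t 0‖ ≤ C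

/-- `x` is the absolutely continuous path on `[0, T]` with `x' = u(t, x)` and `x(0) = x₀`. -/
structure IsIntegralCurveFrom {N : ℕ} (T : ℝ)
    (u : ℝ → EuclideanSpace ℝ (Fin N) → EuclideanSpace ℝ (Fin N))
    (x₀ : EuclideanSpace ℝ (Fin N)) (x : ℝ → EuclideanSpace ℝ (Fin N)) : Prop where
  absolutelyContinuous : AbsolutelyContinuousOnInterval x 0 T
  initial : x 0 = x₀
  hasDerivAt : ∀ᵐ t ∂(volume.restrict (Icc 0 T)), HasDerivAt x (u t (x t)) t

/-- The cost `∫₀ᵀ φ(x(t), x'(t)) dt` of a path.  For continuous `φ` the integrand is bounded and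
measurable along every integral curve of a feasible field. -/
noncomputable def pathCost {N : ℕ} (T : ℝ)
    (φ : EuclideanSpace ℝ (Fin N) × EuclideanSpace ℝ (Fin N) → ℝ)
    (x : ℝ → EuclideanSpace ℝ (Fin N)) : ℝ :=
  ∫ t in (0 : ℝ)..T, φ (x t, deriv x t)

/-- The feasible field `u` is optimal for the variational problem in feedback form: for every
initial point its integral curve costs no more than the one of any other feasible field. -/
structure IsOptimalField {N : ℕ} (T : ℝ)
    (φ : EuclideanSpace ℝ (Fin N) × EuclideanSpace ℝ (Fin N) → ℝ)
    (u : ℝ → EuclideanSpace ℝ (Fin N) → EuclideanSpace ℝ (Fin N)) : Prop where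
  feasible : IsFeasibleField T u
  le_cost : ∀ v : ℝ → EuclideanSpace ℝ (Fin N) → EuclideanSpace ℝ (Fin N), IsFeasibleField T v →
    ∀ (x₀ : EuclideanSpace ℝ (Fin N)) (x y : ℝ → EuclideanSpace ℝ (Fin N)),
      IsIntegralCurveFrom T u x₀ x → IsIntegralCurveFrom T v x₀ y →
        pathCost T φ x ≤ pathCost T φ y

/-- `p` is a (locally Lipschitz, almost everywhere) solution of the linear transport system
`p_t + ∇p u + p ∇u = ∇ₓ[φ(x, u(t, x))]` in `[0, T] × ℝᴺ` with `p(T, ·) = 0`.  The row vector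
`p ∇u` is the column vector `(∇u)ᵀ p`.  All derivatives that occur exist almost everywhere by
Rademacher's theorem (for a spatially Lipschitz `u` and a differentiable `φ`); this is recorded. -/
structure IsTransportSolution {N : ℕ} (T : ℝ)
    (φ : EuclideanSpace ℝ (Fin N) × EuclideanSpace ℝ (Fin N) → ℝ)
    (u p : ℝ → EuclideanSpace ℝ (Fin N) → EuclideanSpace ℝ (Fin N)) : Prop where
  locallyLipschitz : LocallyLipschitzOn (Icc 0 T ×ˢ univ) (uncurry p)
  equation : ∀ᵐ z : ℝ × EuclideanSpace ℝ (Fin N) ∂(volume.restrict (Icc 0 T ×ˢ univ)),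
    DifferentiableAt ℝ (uncurry p) z ∧ DifferentiableAt ℝ (u z.1) z.2 ∧
    deriv (fun s => p s z.2) z.1 + fderiv ℝ (p z.1) z.2 (u z.1 z.2)
        + (fderiv ℝ (u z.1) z.2).adjoint (p z.1 z.2)
      = gradient (fun x => φ (x, u z.1 x)) z.2
  terminal : ∀ x, p T x = 0

/-!
Write `g t x = φ (x, u t x)` for the running cost of the optimal field and `V t x` for its cost-to-go.
Formally, dynamic programming says that `ξ ↦ φ (x, ξ) + ⟪∇V t x, ξ⟫` is minimal at `u t x`, and
differentiating `V_t + ∇V u = -g` in space shows that `-∇V` solves the transport system, so that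
`p = -∇V` and Fermat's rule gives `p = φ_ξ`.  Here `φ` is merely differentiable and `u` merely
Lipschitz in space, so this is carried out along trajectories.

* `IsTransportSolution.exists_lipschitzOnWith`: the transport system forces `∇g` to be locally bounded
  almost everywhere.  Although `g` is not known to be locally Lipschitz (`φ` is not), it is pointwise
  Lipschitz everywhere, so it maps null sets of a line to null sets and the bound of its gradient is a
  Lipschitz constant (`lipschitzOnWith_of_ae_norm_fderiv_le`).
* `IsCaratheodoryField.ae_ae_flow`: the flow maps are bi-Lipschitz, so for almost every initial point
  the transport system holds at almost every time along the trajectory `X`, where it is the adjoint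
  linear system for `p(t, X(t))`.
* `IsCaratheodoryField.tendsto_cost_sub_add_inner`: for such a trajectory, the remaining cost from a
  neighbouring state changes by `-⟪p(t, X(t)), ·⟫` to first order.  This is the statement `∇V = -p`,
  proved by dominated convergence without differentiating the flow.
* `IsOptimalField.le_sub_inner`: a constant velocity `w` on `[t - h, t]` is a feasible variation, and
  `h → 0` in the comparison of costs gives
  `φ (x, u t x) - ⟪p t x, u t x⟫ ≤ φ (x, w) - ⟪p t x, w⟫` at `x = X(t)`.

This inequality involves only continuous functions of `x` (and of `t`, if `u` is continuous).  It
therefore extends from a dense set of trajectories to every point, which the equation `p = φ_ξ` would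
not do since `φ_ξ` need not be continuous.  Fermat's rule then applies at every point.
-/

/-! ### Pointwise Lipschitz functions with bounded gradient -/

open Filter Topology Asymptotics in
theorem continuousAt_of_sub_isBigO {E F : Type*} [NormedAddCommGroup E]
    [NormedAddCommGroup F] {f : E → F} {x : E}
    (hf : (fun y => f y - f x) =O[𝓝 x] fun y => y - x) : ContinuousAt f x := by
  have hid : Tendsto (fun y => y - x) (𝓝 x) (𝓝 0) := tendsto_sub_nhds_zero_iff.2 tendsto_id
  have h : Tendsto (fun y => f y - f x) (𝓝 x) (𝓝 0) := hf.trans_tendsto hid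
  exact tendsto_sub_nhds_zero_iff.1 h

open Filter Topology Asymptotics in
/-- Luzin's condition (N) for functions that are pointwise Lipschitz at every point of `B`. -/
theorem volume_image_eq_zero_of_forall_isBigO {f : ℝ → ℝ} {B : Set ℝ} (hB : volume B = 0)
    (hf : ∀ s ∈ B, (fun y => f y - f s) =O[𝓝 s] fun y => y - s) : volume (f '' B) = 0 := by
  -- `B` is cut into countably many pieces on each of which `f` is Lipschitz.
  let S : ℕ → ℤ → Set ℝ := fun n k =>
    {s ∈ B | (∀ y, |y - s| < 1 / (n + 1 : ℝ) → |f y - f s| ≤ n * |y - s|) ∧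
      ⌊s * (n + 1 : ℝ)⌋ = k}
  have hcover : B ⊆ ⋃ n, ⋃ k, S n k := by
    intro s hs
    obtain ⟨C, hC⟩ := (hf s hs).bound
    obtain ⟨ε, hε, hball⟩ := Metric.eventually_nhds_iff.1 hC
    obtain ⟨n₁, hn₁⟩ := exists_nat_gt C
    obtain ⟨n₂, hn₂⟩ := exists_nat_one_div_lt hε
    refine mem_iUnion₂.2 ⟨max n₁ n₂, _, hs, fun y hy => ?_, rfl⟩
    have h1 : |y - s| < ε := by
      refine hy.trans_le (le_trans ?_ hn₂.le)
      gcongr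
      exact le_max_right _ _
    refine (hball (by simpa [Real.dist_eq] using h1)).trans ?_
    rw [Real.norm_eq_abs]
    gcongr
    exact hn₁.le.trans (by exact_mod_cast le_max_left _ _)
  have hzero : ∀ n k, volume (f '' S n k) = 0 := by
    intro n k
    have hlip : LipschitzOnWith (n : ℝ≥0) f (S n k) := by
      refine LipschitzOnWith.of_dist_le_mul fun x hx y hy => ?_
      rw [Real.dist_eq, Real.dist_eq]
      refine hy.2.1 x ?_
      have hfl : ⌊x * (n + 1 : ℝ)⌋ = ⌊y * (n + 1 : ℝ)⌋ := hx.2.2.trans hy.2.2.symm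
      have h := Int.abs_sub_lt_one_of_floor_eq_floor hfl
      have hn : (0 : ℝ) < n + 1 := by positivity
      rw [← sub_mul, abs_mul, abs_of_pos hn] at h
      rwa [lt_div_iff₀ hn]
    have h := hlip.hausdorffMeasure_image_le (d := 1) zero_le_one
    rw [hausdorffMeasure_real, measure_mono_null (fun s (hs : s ∈ S n k) => hs.1) hB, mul_zero] at h
    exact le_antisymm h bot_le
  refine measure_mono_null (image_mono hcover) ?_
  simp only [image_iUnion]
  exact measure_iUnion_null fun n => measure_iUnion_null fun k => hzero n k

open Filter Topology Asymptotics in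
/-- A mean value inequality for an almost everywhere bound of the derivative.  It fails for the Cantor
function; the pointwise Lipschitz condition at every point excludes that, since the interval of values
is then covered, up to a null set, by the image of the points of differentiability. -/
theorem abs_sub_le_of_ae_norm_deriv_le {f : ℝ → ℝ} {a b C : ℝ} (hab : a ≤ b)
    (hf : ∀ s ∈ Icc a b, (fun y => f y - f s) =O[𝓝 s] fun y => y - s)
    (hd : ∀ᵐ s ∂(volume.restrict (Icc a b)), DifferentiableAt ℝ f s ∧ |deriv f s| ≤ C) :
    |f b - f a| ≤ C * (b - a) := by
  rcases hab.eq_or_lt with rfl | hlt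
  · simp
  have hcont : ContinuousOn f (Icc a b) := fun s hs =>
    (continuousAt_of_sub_isBigO (hf s hs)).continuousWithinAt
  have hC : 0 ≤ C := by
    have hne : (volume.restrict (Icc a b)) ≠ 0 := by
      simp [Measure.restrict_eq_zero, hlt]
    have : NeBot (ae (volume.restrict (Icc a b))) := ae_neBot.2 hne
    obtain ⟨s, hs⟩ := hd.exists
    exact (abs_nonneg _).trans hs.2
  -- A measurable set of full measure in `[a, b]` on which the derivative bound holds.
  rw [ae_restrict_iff' measurableSet_Icc] at hd
  obtain ⟨t, hts, htm, ht⟩ := exists_measurable_superset_of_null (ae_iff.1 hd)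
  set G := Icc a b \ t with hG
  have hgood : ∀ s ∈ G, DifferentiableAt ℝ f s ∧ |deriv f s| ≤ C := by
    intro s hs
    by_contra hcon
    exact hs.2 (hts fun h => hcon (h hs.1))
  have hGm : MeasurableSet G := measurableSet_Icc.diff htm
  have h1 : volume (f '' G) ≤ ENNReal.ofReal (C * (b - a)) := by
    calc volume (f '' G) ≤ ∫⁻ x in G, ENNReal.ofReal |(fderiv ℝ f x).det| :=
          addHaar_image_le_lintegral_abs_det_fderiv volume hGm
            fun x hx => (hgood x hx).1.hasFDerivAt.hasFDerivWithinAt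
      _ ≤ ∫⁻ x in G, ENNReal.ofReal C := by
          refine setLIntegral_mono' hGm fun x hx => ENNReal.ofReal_le_ofReal ?_
          rw [← toSpanSingleton_deriv, ContinuousLinearMap.det_toSpanSingleton]
          exact (hgood x hx).2
      _ ≤ ENNReal.ofReal C * volume (Icc a b) := by
          rw [setLIntegral_const]
          gcongr
          exact sdiff_subset
      _ = ENNReal.ofReal (C * (b - a)) := by
          rw [Real.volume_Icc, ENNReal.ofReal_mul hC]
  have h2 : volume (f '' (Icc a b ∩ t)) = 0 :=
    volume_image_eq_zero_of_forall_isBigO (measure_mono_null inter_subset_right ht)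
      fun s hs => hf s hs.1
  have h3 : uIcc (f a) (f b) ⊆ f '' G ∪ f '' (Icc a b ∩ t) := by
    rw [← image_union, hG, sdiff_union_inter]
    simpa [uIcc_of_le hab] using
      intermediate_value_uIcc (f := f) (a := a) (b := b) (by rwa [uIcc_of_le hab])
  have h4 : ENNReal.ofReal |f b - f a| ≤ ENNReal.ofReal (C * (b - a)) := by
    calc ENNReal.ofReal |f b - f a| = volume (uIcc (f a) (f b)) := Real.volume_interval.symm
      _ ≤ volume (f '' G ∪ f '' (Icc a b ∩ t)) := measure_mono h3
      _ ≤ volume (f '' G) + volume (f '' (Icc a b ∩ t)) := measure_union_le _ _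
      _ ≤ _ := by rw [h2, add_zero]; exact h1
  exact (ENNReal.ofReal_le_ofReal_iff (mul_nonneg hC (sub_nonneg.2 hab))).1 h4

open Filter Topology Asymptotics in
/-- The analogue in finite dimension, by restriction to almost every line in a given direction. -/
theorem lipschitzOnWith_of_ae_norm_fderiv_le {E : Type*} [NormedAddCommGroup E] [NormedSpace ℝ E]
    [FiniteDimensional ℝ E] [MeasurableSpace E] [BorelSpace E] {μ : Measure E} [μ.IsAddHaarMeasure]
    {f : E → ℝ} {U : Set E} {C : ℝ≥0} (hU : IsOpen U) (hconv : Convex ℝ U)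
    (hf : ∀ x ∈ U, (fun y => f y - f x) =O[𝓝 x] fun y => y - x)
    (hd : ∀ᵐ x ∂μ, x ∈ U → DifferentiableAt ℝ f x ∧ ‖fderiv ℝ f x‖ ≤ C) :
    LipschitzOnWith C f U := by
  have hcont : ∀ x ∈ U, ContinuousAt f x := fun x hx => continuousAt_of_sub_isBigO (hf x hx)
  refine LipschitzOnWith.of_dist_le_mul fun y hy x hx => ?_
  set v := y - x with hv
  obtain ⟨t, hts, htm, ht⟩ := exists_measurable_superset_of_null (ae_iff.1 hd)
  -- By Fubini, almost every line in the direction `v` meets the exceptional set in a null set.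
  have hline : ∀ᵐ z ∂μ, ∀ᵐ s : ℝ, z + s • v ∉ t := by
    have hm : MeasurableSet {q : ℝ × E | q.2 + q.1 • v ∉ t} := by
      have : Measurable fun q : ℝ × E => q.2 + q.1 • v := by fun_prop
      exact this htm.compl
    refine (Measure.ae_ae_comm (μ := (volume : Measure ℝ)) (ν := μ)
      (p := fun s z => z + s • v ∉ t) hm).1 (Eventually.of_forall fun s => ?_)
    rw [ae_iff]
    simp only [not_not]
    exact (measure_preimage_add_right μ (s • v) t).trans ht
  have hbound : ∀ᵐ z ∂μ, z ∈ U → z + v ∈ U → |f (z + v) - f z| ≤ C * ‖v‖ := by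
    filter_upwards [hline] with z hz hzU hzvU
    have hseg : ∀ s ∈ Icc (0 : ℝ) 1, z + s • v ∈ U := fun s hs => by
      have := hconv hzU hzvU (sub_nonneg.2 hs.2) hs.1 (by ring)
      convert this using 1
      module
    have hlin : ∀ s : ℝ, HasDerivAt (fun s : ℝ => z + s • v) v s := fun s => by
      simpa using ((hasDerivAt_id s).smul_const v).const_add z
    have h := abs_sub_le_of_ae_norm_deriv_le (f := fun s : ℝ => f (z + s • v)) (a := 0) (b := 1)
      (C := C * ‖v‖) zero_le_one (fun s hs => ?_) ?_
    · simpa using h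
    · refine ((hf _ (hseg s hs)).comp_tendsto (hlin s).continuousAt.tendsto).trans ?_
      exact (hlin s).isBigO_sub
    · rw [ae_restrict_iff' measurableSet_Icc]
      filter_upwards [hz] with s hs hsI
      have hg : DifferentiableAt ℝ f (z + s • v) ∧ ‖fderiv ℝ f (z + s • v)‖ ≤ C := by
        by_contra hcon
        exact hs (hts fun h => hcon (h (hseg s hsI)))
      have hD := hg.1.hasFDerivAt.comp_hasDerivAt s (hlin s)
      refine ⟨hD.differentiableAt, ?_⟩
      have hD' : deriv (fun s : ℝ => f (z + s • v)) s = fderiv ℝ f (z + s • v) v := hD.deriv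
      rw [hD']
      exact ((fderiv ℝ f (z + s • v)).le_opNorm v).trans (by gcongr; exact hg.2)
  have hev : ∀ᶠ z in 𝓝 x, z ∈ U ∧ z + v ∈ U := by
    refine Filter.Eventually.and (hU.mem_nhds hx) ?_
    have : ContinuousAt (fun z => z + v) x := by fun_prop
    exact this (hU.mem_nhds (by simpa [hv] using hy))
  have hfreq : ∃ᶠ z in 𝓝 x, |f (z + v) - f z| ≤ C * ‖v‖ := by
    have hds : Dense {z | z ∈ U → z + v ∈ U → |f (z + v) - f z| ≤ C * ‖v‖} :=
      Measure.dense_of_ae hbound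
    have h1 : ∃ᶠ z in 𝓝 x, z ∈ {z | z ∈ U → z + v ∈ U → |f (z + v) - f z| ≤ C * ‖v‖} :=
      mem_closure_iff_frequently.1 (hds x)
    exact (h1.and_eventually hev).mono fun z hz => hz.1 hz.2.1 hz.2.2
  have hlim : Tendsto (fun z => |f (z + v) - f z|) (𝓝 x) (𝓝 |f (x + v) - f x|) := by
    have h1 : ContinuousAt (fun z => f (z + v)) x := by
      refine ContinuousAt.comp (g := f) (f := fun z => z + v) ?_ (by fun_prop)
      exact hcont _ (by simpa [hv] using hy)
    exact (h1.sub (hcont x hx)).abs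
  have hfin : |f (x + v) - f x| ≤ C * ‖v‖ := by
    by_contra hcon
    exact hfreq ((hlim.eventually (lt_mem_nhds (not_le.1 hcon))).mono fun z hz => not_le.2 hz)
  simpa [Real.dist_eq, dist_eq_norm, hv] using hfin

/-! ### Carathéodory differential equations -/

/-- A time-dependent vector field satisfying the Carathéodory conditions, with constants uniform in
time: measurable, `L`-Lipschitz in space, and bounded by `C` at the origin. -/
structure IsCaratheodoryField {E : Type*} [NormedAddCommGroup E] [MeasurableSpace E]
    (L C : ℝ≥0) (v : ℝ → E → E) : Prop where
  measurable : Measurable (uncurry v)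
  lipschitz : ∀ t, LipschitzWith L (v t)
  norm_zero_le : ∀ t, ‖v t 0‖ ≤ C

/-- A continuous path solving the integral equation of `x' = v(t, x)` for times in `I`.  The path is
continuous on the whole line, but it is constrained on `I` only. -/
structure IsMildSolutionOn {E : Type*} [NormedAddCommGroup E] [NormedSpace ℝ E]
    (v : ℝ → E → E) (I : Set ℝ) (X : ℝ → E) : Prop where
  continuous : Continuous X
  sub_eq : ∀ a ∈ I, ∀ b ∈ I, X b - X a = ∫ r in a..b, v r (X r)

theorem IsMildSolutionOn.mono {E : Type*} [NormedAddCommGroup E] [NormedSpace ℝ E]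
    {v : ℝ → E → E} {I J : Set ℝ} {X : ℝ → E} (h : IsMildSolutionOn v I X) (hJ : J ⊆ I) :
    IsMildSolutionOn v J X :=
  ⟨h.continuous, fun a ha b hb => h.sub_eq a (hJ ha) b (hJ hb)⟩

/-- Changing the field outside the interior of the time interval does not affect solutions. -/
theorem IsMildSolutionOn.congr_field {E : Type*} [NormedAddCommGroup E] [NormedSpace ℝ E]
    {v w : ℝ → E → E} {a b : ℝ} {X : ℝ → E} (h : IsMildSolutionOn v (Icc a b) X)
    (hvw : ∀ r ∈ Ioo a b, v r = w r) : IsMildSolutionOn w (Icc a b) X := by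
  refine ⟨h.continuous, fun s hs t ht => (h.sub_eq s hs t ht).trans ?_⟩
  refine intervalIntegral.integral_congr_ae ?_
  have hb : ∀ᵐ r : ℝ, r ≠ b := by simp [ae_iff, measure_singleton]
  filter_upwards [hb] with r hrb hr
  have h1 : r ∈ Ioc a b := by
    have h2 := hr
    rw [uIoc, mem_Ioc] at h2
    exact ⟨(le_min hs.1 ht.1).trans_lt h2.1, h2.2.trans (max_le hs.2 ht.2)⟩
  rw [hvw r ⟨h1.1, lt_of_le_of_ne h1.2 hrb⟩]

theorem IsCaratheodoryField.norm_le {E : Type*} [NormedAddCommGroup E] [MeasurableSpace E]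
    {L C : ℝ≥0} {v : ℝ → E → E} (hv : IsCaratheodoryField L C v) (t : ℝ) (x : E) :
    ‖v t x‖ ≤ C + L * ‖x‖ := by
  have h1 := (hv.lipschitz t).norm_sub_le x 0
  rw [sub_zero] at h1
  have h2 := norm_le_norm_add_norm_sub' (v t x) (v t 0)
  linarith [hv.norm_zero_le t]

theorem IsCaratheodoryField.measurable_comp {E : Type*} [NormedAddCommGroup E] [MeasurableSpace E]
    [BorelSpace E] {L C : ℝ≥0} {v : ℝ → E → E} (hv : IsCaratheodoryField L C v) {X : ℝ → E}
    (hX : Continuous X) : Measurable fun r => v r (X r) :=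
  hv.measurable.comp (measurable_id.prodMk hX.measurable)

theorem IsCaratheodoryField.intervalIntegrable_comp {E : Type*} [NormedAddCommGroup E]
    [MeasurableSpace E] [BorelSpace E] [SecondCountableTopology E] {L C : ℝ≥0} {v : ℝ → E → E}
    (hv : IsCaratheodoryField L C v) {X : ℝ → E} (hX : Continuous X) (a b : ℝ) :
    IntervalIntegrable (fun r => v r (X r)) volume a b := by
  have hdom : Continuous fun r => (C : ℝ) + L * ‖X r‖ := by fun_prop
  exact (hdom.intervalIntegrable a b).mono_fun' (hv.measurable_comp hX).aestronglyMeasurable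
    (Filter.Eventually.of_forall fun r => hv.norm_le r (X r))

/-- Grönwall's inequality in integral form. -/
theorem le_mul_exp_of_le_add_integral {f : ℝ → ℝ} {δ K b : ℝ} (hf : Continuous f) (hK : 0 ≤ K)
    (h : ∀ s ∈ Icc 0 b, f s ≤ δ + K * ∫ r in (0 : ℝ)..s, f r) :
    ∀ s ∈ Icc 0 b, f s ≤ δ * Real.exp (K * s) := by
  intro s hs
  set G : ℝ → ℝ := fun s => δ + K * ∫ r in (0 : ℝ)..s, f r with hG
  have hderiv : ∀ x, HasDerivAt G (K * f x) x := fun x =>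
    ((hf.integral_hasStrictDerivAt 0 x).hasDerivAt.const_mul K).const_add δ
  have hcont : Continuous G := continuous_iff_continuousAt.2 fun x => (hderiv x).continuousAt
  have hbd := le_gronwallBound_of_liminf_deriv_right_le (f := G) (f' := fun x => K * f x) (δ := δ)
    (K := K) (ε := 0) (a := 0) (b := b) hcont.continuousOn
    (fun x _ r hr => (hderiv x).hasDerivWithinAt.liminf_right_slope_le hr) (by simp [hG])
    (fun x hx => by
      rw [add_zero]
      exact mul_le_mul_of_nonneg_left (h x ⟨hx.1, hx.2.le⟩) hK) s hs
  rw [sub_zero, gronwallBound_ε0] at hbd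
  exact (h s hs).trans hbd

theorem norm_intervalIntegral_le_exp_abs {E : Type*} [NormedAddCommGroup E] [NormedSpace ℝ E]
    {F : ℝ → E} {M K t₀ : ℝ} (hK : 0 < K) (hM : 0 ≤ M)
    (hF : ∀ r, ‖F r‖ ≤ M * Real.exp (K * |r - t₀|)) (s : ℝ) :
    ‖∫ r in t₀..s, F r‖ ≤ M / K * Real.exp (K * |s - t₀|) := by
  have hcont : Continuous fun r => M * Real.exp (K * |r - t₀|) := by fun_prop
  refine (intervalIntegral.norm_integral_le_abs_of_norm_le
    (Filter.Eventually.of_forall fun r => hF r) (hcont.intervalIntegrable _ _)).trans ?_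
  obtain ⟨σ, hσ2, hσ⟩ : ∃ σ : ℝ, σ * σ = 1 ∧ ∀ r ∈ uIcc t₀ s, |r - t₀| = σ * (r - t₀) := by
    rcases le_total t₀ s with h | h
    · refine ⟨1, by simp, fun r hr => ?_⟩
      rw [uIcc_of_le h] at hr
      rw [abs_of_nonneg (sub_nonneg.2 hr.1), one_mul]
    · refine ⟨-1, by simp, fun r hr => ?_⟩
      rw [uIcc_of_ge h] at hr
      rw [abs_of_nonpos (sub_nonpos.2 hr.2), neg_one_mul]
  have hint : ∫ r in t₀..s, M * Real.exp (K * |r - t₀|) =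
      σ * (M / K) * Real.exp (K * (σ * (s - t₀))) - σ * (M / K) := by
    have hd : ∀ r, HasDerivAt (fun r => σ * (M / K) * Real.exp (K * (σ * (r - t₀))))
        (M * Real.exp (K * (σ * (r - t₀)))) r := by
      intro r
      have h1 : HasDerivAt (fun r => K * (σ * (r - t₀))) (K * (σ * 1)) r :=
        (((hasDerivAt_id r).sub_const t₀).const_mul σ).const_mul K
      refine (h1.exp.const_mul (σ * (M / K))).congr_deriv ?_
      linear_combination (σ * σ * Real.exp (K * (σ * (r - t₀)))) * div_mul_cancel₀ M hK.ne' +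
        M * Real.exp (K * (σ * (r - t₀))) * hσ2
    have h2 := intervalIntegral.integral_eq_sub_of_hasDerivAt (fun r _ => hd r)
      ((by fun_prop :
        Continuous fun r => M * Real.exp (K * (σ * (r - t₀)))).intervalIntegrable t₀ s)
    rw [intervalIntegral.integral_congr (g := fun r => M * Real.exp (K * (σ * (r - t₀))))
      (fun r hr => by simp only [hσ r hr]), h2]
    simp
  have h1 : 1 ≤ Real.exp (K * |s - t₀|) := Real.one_le_exp (by positivity)
  have hσa : |σ| = 1 := by
    have := abs_mul_abs_self σ
    rw [hσ2] at this
    nlinarith [abs_nonneg σ]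
  rw [hint, ← hσ s right_mem_uIcc,
    show σ * (M / K) * Real.exp (K * |s - t₀|) - σ * (M / K) =
      σ * (M / K * (Real.exp (K * |s - t₀|) - 1)) by ring, abs_mul, hσa, one_mul,
    abs_of_nonneg (mul_nonneg (by positivity) (sub_nonneg.2 h1))]
  gcongr
  linarith

/-- Mild solutions are Lipschitz in time on bounded intervals. -/
theorem IsCaratheodoryField.exists_lipschitzOnWith {E : Type*} [NormedAddCommGroup E]
    [NormedSpace ℝ E] [MeasurableSpace E] {L C : ℝ≥0} {v : ℝ → E → E}
    (hv : IsCaratheodoryField L C v)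
    {a b : ℝ}
    {X : ℝ → E} (hX : IsMildSolutionOn v (Icc a b) X) :
    ∃ M, LipschitzOnWith M X (Icc a b) := by
  obtain ⟨R, hR⟩ := isCompact_Icc.exists_bound_of_continuousOn (s := Icc a b)
    hX.continuous.continuousOn
  refine ⟨C + L * R.toNNReal, LipschitzOnWith.of_dist_le_mul fun s hs t ht => ?_⟩
  rw [dist_eq_norm, hX.sub_eq t ht s hs, Real.dist_eq]
  refine intervalIntegral.norm_integral_le_of_norm_le_const fun r hr => ?_
  refine (hv.norm_le r (X r)).trans ?_
  have hr' : r ∈ Icc a b := OrdConnected.uIcc_subset ordConnected_Icc ht hs (uIoc_subset_uIcc hr)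
  have h1 : ‖X r‖ ≤ R.toNNReal := (hR r hr').trans (Real.le_coe_toNNReal R)
  rw [NNReal.coe_add, NNReal.coe_mul]
  exact add_le_add_right (mul_le_mul_of_nonneg_left h1 L.coe_nonneg) _

section Flow

variable {E : Type*} [NormedAddCommGroup E] [NormedSpace ℝ E] [MeasurableSpace E] [BorelSpace E]
  [SecondCountableTopology E] {L C : ℝ≥0} {v : ℝ → E → E}

/-- Two solutions separate at most exponentially, forwards and backwards in time. -/
theorem IsCaratheodoryField.norm_sub_le_mul_exp (hv : IsCaratheodoryField L C v)
    {I : Set ℝ} [I.OrdConnected] {X Y : ℝ → E} (hX : IsMildSolutionOn v I X)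
    (hY : IsMildSolutionOn v I Y) {s t : ℝ} (hs : s ∈ I) (ht : t ∈ I) :
    ‖Y s - X s‖ ≤ ‖Y t - X t‖ * Real.exp (L * |s - t|) := by
  -- The direction `σ` of time turns both cases into Grönwall's inequality on `[0, |s - t|]`.
  obtain ⟨σ, hσ1, hσ⟩ : ∃ σ : ℝ, |σ| = 1 ∧ s = t + σ * |s - t| := by
    rcases le_total t s with h | h
    · exact ⟨1, by simp, by rw [abs_of_nonneg (sub_nonneg.2 h)]; ring⟩
    · exact ⟨-1, by simp, by rw [abs_of_nonpos (sub_nonpos.2 h)]; ring⟩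
  have hmem : ∀ r ∈ Icc 0 |s - t|, t + σ * r ∈ I := by
    intro r hr
    refine OrdConnected.uIcc_subset ‹_› ht hs ?_
    rcases (abs_eq zero_le_one).1 hσ1 with h | h
    · subst h
      exact mem_uIcc.2 (Or.inl ⟨by linarith [hr.1], by linarith [hr.2]⟩)
    · subst h
      exact mem_uIcc.2 (Or.inr ⟨by linarith [hr.2], by linarith [hr.1]⟩)
  have hXc := hX.continuous
  have hYc := hY.continuous
  have key := le_mul_exp_of_le_add_integral (f := fun r => ‖Y (t + σ * r) - X (t + σ * r)‖)
    (δ := ‖Y t - X t‖) (K := L) (b := |s - t|) (by fun_prop) L.2 (fun r hr => ?_)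
    |s - t| (right_mem_Icc.2 (abs_nonneg _))
  · simpa only [← hσ] using key
  · have h1 : Y (t + σ * r) - X (t + σ * r) = (Y t - X t) +
        ∫ ρ in t..(t + σ * r), (v ρ (Y ρ) - v ρ (X ρ)) := by
      rw [intervalIntegral.integral_sub (hv.intervalIntegrable_comp hYc _ _)
        (hv.intervalIntegrable_comp hXc _ _), ← hX.sub_eq t ht _ (hmem r hr),
        ← hY.sub_eq t ht _ (hmem r hr)]
      abel
    have h2 : ‖∫ ρ in t..(t + σ * r), (v ρ (Y ρ) - v ρ (X ρ))‖ ≤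
        |∫ ρ in t..(t + σ * r), L * ‖Y ρ - X ρ‖| := by
      refine intervalIntegral.norm_integral_le_abs_of_norm_le
        (Filter.Eventually.of_forall fun ρ => (hv.lipschitz ρ).norm_sub_le _ _) ?_
      exact Continuous.intervalIntegrable (by fun_prop) _ _
    have h3 : ∫ ρ in t..(t + σ * r), L * ‖Y ρ - X ρ‖ =
        L * (σ * ∫ ρ in (0 : ℝ)..r, ‖Y (t + σ * ρ) - X (t + σ * ρ)‖) := by
      rw [intervalIntegral.integral_const_mul,
        intervalIntegral.mul_integral_comp_add_mul (f := fun ρ => ‖Y ρ - X ρ‖)]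
      simp
    have h4 : 0 ≤ ∫ ρ in (0 : ℝ)..r, ‖Y (t + σ * ρ) - X (t + σ * ρ)‖ :=
      intervalIntegral.integral_nonneg hr.1 fun _ _ => norm_nonneg _
    rw [h3, abs_mul, abs_mul, hσ1, one_mul, abs_of_nonneg h4, abs_of_nonneg L.coe_nonneg] at h2
    rw [h1]
    exact (norm_add_le _ _).trans (add_le_add_right h2 _)

theorem IsCaratheodoryField.eq_of_eq (hv : IsCaratheodoryField L C v)
    {I : Set ℝ} [I.OrdConnected] {X Y : ℝ → E} (hX : IsMildSolutionOn v I X)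
    (hY : IsMildSolutionOn v I Y) {s t : ℝ} (hs : s ∈ I) (ht : t ∈ I) (h : Y t = X t) :
    Y s = X s := by
  have := hv.norm_sub_le_mul_exp hX hY hs ht
  rw [h, sub_self, norm_zero, zero_mul] at this
  exact sub_eq_zero.1 (norm_le_zero_iff.1 this)

open BoundedContinuousFunction in
/-- Carathéodory's existence theorem on the whole line, from an arbitrary initial time. -/
theorem IsCaratheodoryField.exists_isMildSolutionOn [CompleteSpace E]
    (hv : IsCaratheodoryField L C v) (t₀ : ℝ) (x₀ : E) :
    ∃ X : ℝ → E, IsMildSolutionOn v univ X ∧ X t₀ = x₀ := by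
  -- With the unknown `X(s) = exp(K |s - t₀|) Y(s)`, `Y` bounded, the integral operator is a
  -- contraction in the supremum norm as soon as `K > L`.
  set K : ℝ := L + 1 with hKdef
  have hK : 0 < K := by positivity
  set wt : ℝ → ℝ := fun r => Real.exp (K * |r - t₀|) with hwt
  have hwtc : Continuous wt := by simp only [hwt]; fun_prop
  have hwt0 : ∀ r, 0 < wt r := fun r => Real.exp_pos _
  have hwt1 : ∀ r, 1 ≤ wt r := fun r => Real.one_le_exp (by positivity)
  have hc : ∀ Y : ℝ →ᵇ E, Continuous fun r => wt r • Y r := fun Y => hwtc.smul Y.continuous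
  have hbd : ∀ (Y : ℝ →ᵇ E) r, ‖v r (wt r • Y r)‖ ≤ (C + L * ‖Y‖) * wt r := by
    intro Y r
    refine (hv.norm_le r _).trans ?_
    rw [norm_smul, Real.norm_of_nonneg (hwt0 r).le]
    have h1 : (C : ℝ) ≤ C * wt r := le_mul_of_one_le_right C.2 (hwt1 r)
    have h2 : (L : ℝ) * (wt r * ‖Y r‖) ≤ L * (wt r * ‖Y‖) := by
      have := (hwt0 r).le
      gcongr
      exact Y.norm_coe_le_norm r
    linarith
  have hdiff : ∀ (Y Z : ℝ →ᵇ E) r,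
      ‖v r (wt r • Y r) - v r (wt r • Z r)‖ ≤ (L * dist Y Z) * wt r := by
    intro Y Z r
    refine ((hv.lipschitz r).norm_sub_le _ _).trans ?_
    rw [← smul_sub, norm_smul, Real.norm_of_nonneg (hwt0 r).le, ← dist_eq_norm]
    have h2 : (L : ℝ) * (wt r * dist (Y r) (Z r)) ≤ L * (wt r * dist Y Z) := by
      have := (hwt0 r).le
      gcongr
      exact Y.dist_coe_le_dist r
    linarith
  let Q : (ℝ →ᵇ E) → (ℝ →ᵇ E) := fun Y =>
    BoundedContinuousFunction.ofNormedAddCommGroup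
      (fun s => (wt s)⁻¹ • (x₀ + ∫ r in t₀..s, v r (wt r • Y r)))
      ((hwtc.inv₀ fun r => (hwt0 r).ne').smul (continuous_const.add
        (intervalIntegral.continuous_primitive
          (fun a b => hv.intervalIntegrable_comp (hc Y) a b) t₀)))
      (‖x₀‖ + (C + L * ‖Y‖) / K) (fun s => by
        have h1 := norm_intervalIntegral_le_exp_abs hK (by positivity) (hbd Y) s
        rw [norm_smul, norm_inv, Real.norm_of_nonneg (hwt0 s).le, inv_mul_le_iff₀ (hwt0 s)]
        have h2 : ‖x₀‖ ≤ wt s * ‖x₀‖ := le_mul_of_one_le_left (norm_nonneg _) (hwt1 s)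
        calc _ ≤ ‖x₀‖ + (C + L * ‖Y‖) / K * wt s := (norm_add_le _ _).trans (by gcongr)
          _ ≤ _ := by linarith)
  have hQ : ∀ Y s, Q Y s = (wt s)⁻¹ • (x₀ + ∫ r in t₀..s, v r (wt r • Y r)) := fun Y s => rfl
  have hcontr : ContractingWith (L / (L + 1)) Q := by
    refine ⟨(div_lt_one (by positivity)).2 (lt_add_one L), LipschitzWith.of_dist_le_mul
      fun Y Z => (BoundedContinuousFunction.dist_le (by positivity)).2 fun s => ?_⟩
    have h1 := norm_intervalIntegral_le_exp_abs hK (by positivity) (hdiff Y Z) s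
    rw [dist_eq_norm, hQ, hQ, ← smul_sub, add_sub_add_left_eq_sub,
      ← intervalIntegral.integral_sub (hv.intervalIntegrable_comp (hc Y) _ _)
      (hv.intervalIntegrable_comp (hc Z) _ _), norm_smul, norm_inv,
      Real.norm_of_nonneg (hwt0 s).le, inv_mul_le_iff₀ (hwt0 s)]
    refine h1.trans (le_of_eq ?_)
    push_cast
    simp only [hKdef, hwt]
    ring
  obtain ⟨Y, hY⟩ : ∃ Y, Q Y = Y := ⟨_, hcontr.fixedPoint_isFixedPt⟩
  have hXeq : ∀ s, wt s • Y s = x₀ + ∫ r in t₀..s, v r (wt r • Y r) := fun s => by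
    conv_lhs => rw [← hY, hQ, smul_smul, mul_inv_cancel₀ (hwt0 s).ne', one_smul]
  refine ⟨fun s => wt s • Y s, ⟨hc Y, fun a _ b _ => ?_⟩, ?_⟩
  · rw [hXeq, hXeq, add_sub_add_left_eq_sub, intervalIntegral.integral_interval_sub_left
      (hv.intervalIntegrable_comp (hc Y) _ _) (hv.intervalIntegrable_comp (hc Y) _ _)]
  · simp only [hXeq t₀, intervalIntegral.integral_same, add_zero]

theorem IsCaratheodoryField.ae_hasDerivAt [CompleteSpace E] (hv : IsCaratheodoryField L C v)
    {a b : ℝ} {X : ℝ → E} (hX : IsMildSolutionOn v (Icc a b) X) (hab : a ≤ b) :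
    ∀ᵐ r ∂(volume.restrict (Icc a b)), HasDerivAt X (v r (X r)) r := by
  rw [ae_restrict_iff' measurableSet_Icc]
  have ha : ∀ᵐ r : ℝ, r ≠ a := by simp [ae_iff, measure_singleton]
  have hb : ∀ᵐ r : ℝ, r ≠ b := by simp [ae_iff, measure_singleton]
  filter_upwards [(hv.intervalIntegrable_comp hX.continuous a b).ae_hasDerivAt_integral, ha, hb]
    with r hr hra hrb hI
  rw [uIcc_of_le hab] at hr
  have h1 := (hr hI a (left_mem_Icc.2 hab)).const_add (X a)
  refine h1.congr_of_eventuallyEq ?_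
  filter_upwards [Icc_mem_nhds (lt_of_le_of_ne hI.1 hra.symm) (lt_of_le_of_ne hI.2 hrb)] with s hs
  rw [← hX.sub_eq a (left_mem_Icc.2 hab) s hs, add_sub_cancel]

end Flow

/-! ### Null sets and the flow -/

section NullSets

variable {E : Type*} [NormedAddCommGroup E] [NormedSpace ℝ E] [FiniteDimensional ℝ E]
  [MeasurableSpace E] [BorelSpace E] {μ : Measure E} [μ.IsAddHaarMeasure]

open Measure in
theorem AntilipschitzWith.addHaar_preimage_eq_zero {K : ℝ≥0} {f : E → E}
    (hf : AntilipschitzWith K f) {s : Set E} (hs : μ s = 0) : μ (f ⁻¹' s) = 0 := by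
  have h1 : (μH[Module.finrank ℝ E] : Measure E) s = 0 :=
    absolutelyContinuous_isAddHaarMeasure _ μ hs
  refine absolutelyContinuous_isAddHaarMeasure _ (μH[Module.finrank ℝ E]) ?_
  have h2 := hf.hausdorffMeasure_preimage_le (d := Module.finrank ℝ E) (by positivity) s
  rw [h1, mul_zero] at h2
  exact le_antisymm h2 bot_le

theorem IsCaratheodoryField.lipschitzWith_flow {L C : ℝ≥0} {v : ℝ → E → E}
    (hv : IsCaratheodoryField L C v) {X : E → ℝ → E} (hX : ∀ x, IsMildSolutionOn v univ (X x))
    (hX0 : ∀ x, X x 0 = x) (s : ℝ) :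
    LipschitzWith (Real.exp (L * |s|)).toNNReal fun x => X x s := by
  refine LipschitzWith.of_dist_le_mul fun x y => ?_
  have h := hv.norm_sub_le_mul_exp (hX y) (hX x) (mem_univ s) (mem_univ 0)
  rw [hX0, hX0, sub_zero] at h
  rw [dist_eq_norm, dist_eq_norm, Real.coe_toNNReal _ (Real.exp_pos _).le, mul_comm]
  exact h

theorem IsCaratheodoryField.antilipschitzWith_flow {L C : ℝ≥0} {v : ℝ → E → E}
    (hv : IsCaratheodoryField L C v) {X : E → ℝ → E} (hX : ∀ x, IsMildSolutionOn v univ (X x))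
    (hX0 : ∀ x, X x 0 = x) (s : ℝ) :
    AntilipschitzWith (Real.exp (L * |s|)).toNNReal fun x => X x s := by
  refine AntilipschitzWith.of_le_mul_dist fun x y => ?_
  have h := hv.norm_sub_le_mul_exp (hX y) (hX x) (mem_univ 0) (mem_univ s)
  rw [hX0, hX0, zero_sub, abs_neg] at h
  rw [dist_eq_norm, dist_eq_norm, Real.coe_toNNReal _ (Real.exp_pos _).le, mul_comm]
  exact h

theorem IsCaratheodoryField.surjective_flow {L C : ℝ≥0} {v : ℝ → E → E}
    (hv : IsCaratheodoryField L C v) {X : E → ℝ → E} (hX : ∀ x, IsMildSolutionOn v univ (X x))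
    (hX0 : ∀ x, X x 0 = x) (s : ℝ) : Surjective fun x => X x s := by
  intro y
  obtain ⟨Y, hY, hYs⟩ := hv.exists_isMildSolutionOn s y
  refine ⟨Y 0, ?_⟩
  rw [← hYs]
  exact hv.eq_of_eq hY (hX (Y 0)) (mem_univ s) (mem_univ 0) (hX0 _)

/-- A property that holds almost everywhere in space-time holds, for almost every initial point, at
almost every time along the trajectory: the time-`s` maps of the flow are bi-Lipschitz, so pull back
null sets to null sets. -/
theorem IsCaratheodoryField.ae_ae_flow {L C : ℝ≥0} {v : ℝ → E → E}
    (hv : IsCaratheodoryField L C v) {X : E → ℝ → E} (hX : ∀ x, IsMildSolutionOn v univ (X x))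
    (hX0 : ∀ x, X x 0 = x) {P : ℝ × E → Prop}
    (hP : ∀ᵐ z ∂((volume : Measure ℝ).prod μ), P z) :
    ∀ᵐ x ∂μ, ∀ᵐ s : ℝ, P (s, X x s) := by
  obtain ⟨t, hts, htm, ht⟩ := exists_measurable_superset_of_null (ae_iff.1 hP)
  have hXm : Measurable fun q : ℝ × E => X q.2 q.1 := by
    have h := measurable_uncurry_of_continuous_of_measurable (u := fun (s : ℝ) (x : E) => X x s)
      (fun x => (hX x).continuous) fun s => (hv.lipschitzWith_flow hX hX0 s).continuous.measurable
    exact h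
  have hm : MeasurableSet {q : ℝ × E | (q.1, X q.2 q.1) ∉ t} :=
    (measurable_fst.prodMk hXm) htm.compl
  have h1 : ∀ᵐ s : ℝ, ∀ᵐ x ∂μ, (s, X x s) ∉ t := by
    filter_upwards [Measure.ae_ae_of_ae_prod (measure_eq_zero_iff_ae_notMem.1 ht)] with s hs
    have h2 := (hv.antilipschitzWith_flow hX hX0 s).addHaar_preimage_eq_zero (μ := μ)
      (measure_eq_zero_iff_ae_notMem.2 hs : μ {x | (s, x) ∈ t} = 0)
    exact measure_eq_zero_iff_ae_notMem.1 h2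
  filter_upwards [(Measure.ae_ae_comm (p := fun s x => (s, X x s) ∉ t) hm).1 h1] with x hx
  filter_upwards [hx] with s hs
  by_contra hcon
  exact hs (hts hcon)

end NullSets

/-! ### Regularity of the running cost -/

theorem norm_gradient_eq_norm_fderiv {E : Type*} [NormedAddCommGroup E] [InnerProductSpace ℝ E]
    [CompleteSpace E] (f : E → ℝ) (x : E) : ‖gradient f x‖ = ‖fderiv ℝ f x‖ := by
  rw [gradient, LinearIsometryEquiv.norm_map]

open Topology in
/-- Along a spatially Lipschitz field with a locally Lipschitz solution `p` of the transport system,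
the running cost is locally Lipschitz in space, uniformly in time.  Its gradient is almost everywhere
equal to a locally bounded expression in `p` and `u`, and since the running cost is pointwise
Lipschitz everywhere, the almost everywhere bound of the gradient is a Lipschitz constant. -/
theorem IsTransportSolution.exists_lipschitzOnWith {N : ℕ} {T : ℝ}
    {φ : EuclideanSpace ℝ (Fin N) × EuclideanSpace ℝ (Fin N) → ℝ} (hφ : Differentiable ℝ φ)
    {u p : ℝ → EuclideanSpace ℝ (Fin N) → EuclideanSpace ℝ (Fin N)} (hu : IsFeasibleField T u)
    (hp : IsTransportSolution T φ u p) (R : ℝ) :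
    ∃ M : ℝ≥0, ∀ᵐ t ∂(volume.restrict (Icc 0 T)),
      LipschitzOnWith M (fun x => φ (x, u t x)) (Metric.ball 0 R) := by
  obtain ⟨L, hL⟩ := hu.lipschitz
  obtain ⟨C, hC⟩ := hu.bounded_zero
  have hK : IsCompact (Icc 0 T ×ˢ Metric.closedBall (0 : EuclideanSpace ℝ (Fin N)) R) :=
    isCompact_Icc.prod (isCompact_closedBall 0 R)
  have hpK := hp.locallyLipschitz.mono (prod_mono_right (subset_univ (Metric.closedBall 0 R)))
  obtain ⟨Kp, hKp⟩ := hpK.exists_lipschitzOnWith_of_compact hK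
  obtain ⟨B, hB⟩ := hK.exists_bound_of_continuousOn hKp.continuousOn
  have hslice_t : ∀ x ∈ Metric.closedBall (0 : EuclideanSpace ℝ (Fin N)) R,
      LipschitzOnWith Kp (fun s => p s x) (Icc 0 T) := fun x hx =>
    LipschitzOnWith.of_dist_le_mul fun s hs t ht => by
      simpa [Prod.dist_eq] using hKp.dist_le_mul (s, x) ⟨hs, hx⟩ (t, x) ⟨ht, hx⟩
  have hslice_x : ∀ t ∈ Icc 0 T, LipschitzOnWith Kp (p t) (Metric.closedBall 0 R) := fun t ht =>
    LipschitzOnWith.of_dist_le_mul fun x hx y hy => by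
      simpa [Prod.dist_eq] using hKp.dist_le_mul (t, x) ⟨ht, hx⟩ (t, y) ⟨ht, hy⟩
  refine ⟨(Kp + Kp * (C + L * R) + L * B).toNNReal, ?_⟩
  have heq := (ae_restrict_iff' (measurableSet_Icc.prod MeasurableSet.univ)).1 hp.equation
  rw [Measure.volume_eq_prod] at heq
  rw [ae_restrict_iff' measurableSet_Icc]
  have ha : ∀ᵐ r : ℝ, r ≠ 0 := by simp [ae_iff, measure_singleton]
  have hb : ∀ᵐ r : ℝ, r ≠ T := by simp [ae_iff, measure_singleton]
  filter_upwards [Measure.ae_ae_of_ae_prod heq, ha, hb] with t ht ht0 htT htI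
  refine lipschitzOnWith_of_ae_norm_fderiv_le (μ := volume) Metric.isOpen_ball (convex_ball 0 R)
    (fun x _ => ?_) ?_
  · have hc : LipschitzWith (max 1 L) fun y => (y, u t y) := LipschitzWith.id.prodMk (hL t htI)
    have h1 : ContinuousAt (fun y => (y, u t y)) x := hc.continuous.continuousAt
    refine ((hφ (x, u t x)).isBigO_sub.comp_tendsto h1.tendsto).trans ?_
    exact Asymptotics.IsBigO.of_bound _ (Filter.Eventually.of_forall fun y => hc.norm_sub_le y x)
  · filter_upwards [ht] with x hx hxR
    obtain ⟨-, hux, hxeq⟩ := hx ⟨htI, mem_univ _⟩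
    have hxR' := Metric.ball_subset_closedBall hxR
    have htn : Icc 0 T ∈ 𝓝 t :=
      Icc_mem_nhds (lt_of_le_of_ne htI.1 ht0.symm) (lt_of_le_of_ne htI.2 htT)
    have hxn : Metric.closedBall (0 : EuclideanSpace ℝ (Fin N)) R ∈ 𝓝 x :=
      Filter.mem_of_superset (Metric.isOpen_ball.mem_nhds hxR) Metric.ball_subset_closedBall
    have hxnorm : ‖x‖ ≤ R := by simpa using hxR'
    have hunorm : ‖u t x‖ ≤ C + L * R := by
      have h1 := (hL t htI).norm_sub_le x 0
      rw [sub_zero] at h1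
      have h2 := norm_le_norm_add_norm_sub' (u t x) (u t 0)
      have h3 : (L : ℝ) * ‖x‖ ≤ L * R := by gcongr
      linarith [hC t htI]
    refine ⟨(hφ _).comp x (differentiableAt_id.prodMk hux), ?_⟩
    rw [← norm_gradient_eq_norm_fderiv, ← hxeq]
    refine le_trans ?_ (Real.le_coe_toNNReal _)
    refine (norm_add₃_le).trans ?_
    gcongr
    · exact norm_deriv_le_of_lipschitzOn htn (hslice_t x hxR')
    · refine ((fderiv ℝ (p t) x).le_opNorm _).trans ?_
      gcongr
      exact norm_fderiv_le_of_lipschitzOn ℝ hxn (hslice_x t htI)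
    · refine (ContinuousLinearMap.le_opNorm _ _).trans ?_
      rw [LinearIsometryEquiv.norm_map]
      gcongr
      · exact norm_fderiv_le_of_lipschitz ℝ (hL t htI)
      · exact hB (t, x) ⟨htI, hxR'⟩

/-! ### First order sensitivity of the cost -/

theorem IsCaratheodoryField.intervalIntegrable_comp_continuous {E : Type*} [NormedAddCommGroup E]
    [NormedSpace ℝ E] [FiniteDimensional ℝ E] [MeasurableSpace E] [BorelSpace E] {L C : ℝ≥0}
    {v : ℝ → E → E} (hv : IsCaratheodoryField L C v) {φ : E × E → ℝ} (hφ : Continuous φ)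
    {X : ℝ → E} (hX : Continuous X) (a b : ℝ) :
    IntervalIntegrable (fun r => φ (X r, v r (X r))) volume a b := by
  have : ProperSpace E := FiniteDimensional.proper ℝ E
  obtain ⟨R, hR⟩ := isCompact_uIcc.exists_bound_of_continuousOn (s := uIcc a b) hX.continuousOn
  obtain ⟨M, hM⟩ := ((isCompact_closedBall (0 : E) R).prod
    (isCompact_closedBall (0 : E) (C + L * R))).exists_bound_of_continuousOn hφ.continuousOn
  rw [intervalIntegrable_iff]
  refine Measure.integrableOn_of_bounded (M := M) (by simp [uIoc]) ?_ ?_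
  · exact (hφ.measurable.comp (hX.measurable.prodMk (hv.measurable_comp hX))).aestronglyMeasurable
  · refine (ae_restrict_iff' measurableSet_uIoc).2 (Filter.Eventually.of_forall fun r hr => ?_)
    have h1 := hR r (uIoc_subset_uIcc hr)
    refine hM _ ⟨by simpa using h1, ?_⟩
    have h2 : (L : ℝ) * ‖X r‖ ≤ L * R := by gcongr
    simpa using (hv.norm_le r (X r)).trans (by linarith)

theorem LipschitzOnWith.exists_lipschitzOnWith_inner {E : Type*} [NormedAddCommGroup E]
    [InnerProductSpace ℝ E] {f g : ℝ → E} {a b : ℝ} {K M : ℝ≥0}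
    (hf : LipschitzOnWith K f (Icc a b)) (hg : LipschitzOnWith M g (Icc a b)) :
    ∃ Q, LipschitzOnWith Q (fun s => inner ℝ (f s) (g s)) (Icc a b) := by
  obtain ⟨A, hA⟩ := isCompact_Icc.exists_bound_of_continuousOn hf.continuousOn
  obtain ⟨B, hB⟩ := isCompact_Icc.exists_bound_of_continuousOn hg.continuousOn
  refine ⟨K * B.toNNReal + A.toNNReal * M, LipschitzOnWith.of_dist_le_mul fun s hs t ht => ?_⟩
  have h1 : inner ℝ (f s) (g s) - inner ℝ (f t) (g t) =
      inner ℝ (f s - f t) (g s) + inner ℝ (f t) (g s - g t) := by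
    rw [inner_sub_left, inner_sub_right]
    ring
  rw [Real.dist_eq, h1]
  refine (abs_add_le _ _).trans ?_
  have h2 := abs_real_inner_le_norm (f s - f t) (g s)
  have h3 := abs_real_inner_le_norm (f t) (g s - g t)
  have h4 : ‖f s - f t‖ ≤ K * dist s t := by simpa [dist_eq_norm] using hf.dist_le_mul s hs t ht
  have h5 : ‖g s - g t‖ ≤ M * dist s t := by simpa [dist_eq_norm] using hg.dist_le_mul s hs t ht
  have h6 : ‖g s‖ ≤ B.toNNReal := (hB s hs).trans (Real.le_coe_toNNReal B)
  have h7 : ‖f t‖ ≤ A.toNNReal := (hA t ht).trans (Real.le_coe_toNNReal A)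
  have h8 : ‖f s - f t‖ * ‖g s‖ ≤ (K * dist s t) * B.toNNReal := by gcongr
  have h9 : ‖f t‖ * ‖g s - g t‖ ≤ A.toNNReal * (M * dist s t) := by gcongr
  push_cast
  linarith

/-- The transport system holds, with all its derivatives, along the path `X` at time `s`; the field
is `v` and the right hand side is the gradient of the running cost `g s`. -/
structure IsTransportAt {E : Type*} [NormedAddCommGroup E] [InnerProductSpace ℝ E]
    [FiniteDimensional ℝ E] (v p : ℝ → E → E) (g : ℝ → E → ℝ) (X : ℝ → E) (s : ℝ) : Prop where
  differentiableAt_p : DifferentiableAt ℝ (uncurry p) (s, X s)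
  differentiableAt_field : DifferentiableAt ℝ (v s) (X s)
  differentiableAt_cost : DifferentiableAt ℝ (g s) (X s)
  equation : deriv (fun r => p r (X s)) s + fderiv ℝ (p s) (X s) (v s (X s))
      + (fderiv ℝ (v s) (X s)).adjoint (p s (X s)) = gradient (g s) (X s)

/-- Along a trajectory the transport system is the adjoint linear system. -/
theorem IsTransportAt.hasDerivAt {E : Type*} [NormedAddCommGroup E] [InnerProductSpace ℝ E]
    [FiniteDimensional ℝ E] {v p : ℝ → E → E} {g : ℝ → E → ℝ} {X : ℝ → E} {s : ℝ}
    (h : IsTransportAt v p g X s) (hX : HasDerivAt X (v s (X s)) s) :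
    HasDerivAt (fun r => p r (X r))
      (gradient (g s) (X s) - (fderiv ℝ (v s) (X s)).adjoint (p s (X s))) s := by
  have hD := h.differentiableAt_p.hasFDerivAt
  have hpath : HasDerivAt (fun r => (r, X r)) ((1 : ℝ), v s (X s)) s :=
    (hasDerivAt_id s).prodMk hX
  have h1 := hD.comp_hasDerivAt s hpath
  have hconst : HasDerivAt (fun r => (r, X s)) ((1 : ℝ), (0 : E)) s :=
    (hasDerivAt_id s).prodMk (hasDerivAt_const s (X s))
  have h2 := hD.comp_hasDerivAt s hconst
  have ht : HasDerivAt (fun r => p r (X s))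
      (fderiv ℝ (uncurry p) (s, X s) ((1 : ℝ), (0 : E))) s := h2
  have hx : HasFDerivAt (p s) ((fderiv ℝ (uncurry p) (s, X s)).comp
      (ContinuousLinearMap.inr ℝ ℝ E)) (X s) :=
    HasFDerivAt.comp (X s) hD (hasFDerivAt_prodMk_right s (X s))
  refine h1.congr_deriv ?_
  rw [← h.equation, ht.deriv, hx.fderiv, add_sub_cancel_right, ContinuousLinearMap.comp_apply,
    ContinuousLinearMap.inr_apply, ← map_add]
  simp

open Filter Topology in
/-- First order sensitivity of the cost-to-go: its gradient in the state at time `a` is `-p`.  The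
derivative of `⟪p(s, X(s)), Y(s) - X(s)⟫` in time is the linearisation of the difference of the
running costs, up to the first order remainders of the field and of the running cost; these are
`o(h)` pointwise and `O(h)` uniformly, so their integral is `o(h)`.  The path `X` is fixed, and no
differentiability of the flow is involved. -/
theorem IsCaratheodoryField.tendsto_cost_sub_add_inner {E : Type*} [NormedAddCommGroup E]
    [InnerProductSpace ℝ E] [FiniteDimensional ℝ E] [MeasurableSpace E] [BorelSpace E]
    {L C : ℝ≥0} {v : ℝ → E → E}
    (hv : IsCaratheodoryField L C v) {φ : E × E → ℝ} (hφ : Continuous φ) {p : ℝ → E → E}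
    {a b : ℝ} (hab : a ≤ b) (hp : LocallyLipschitzOn (Icc a b ×ˢ univ) (uncurry p))
    (hpb : ∀ x, p b x = 0)
    (hg : ∀ R : ℝ, ∃ M : ℝ≥0, ∀ᵐ s ∂(volume.restrict (Icc a b)),
      LipschitzOnWith M (fun x => φ (x, v s x)) (Metric.ball 0 R))
    {X : ℝ → E} (hX : IsMildSolutionOn v (Icc a b) X)
    (hgood : ∀ᵐ s ∂(volume.restrict (Icc a b)),
      IsTransportAt v p (fun s x => φ (x, v s x)) X s)
    {Y : ℝ → ℝ → E} (hY : ∀ᶠ h in 𝓝[>] (0 : ℝ), IsMildSolutionOn v (Icc a b) (Y h))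
    {K : ℝ} (hYK : ∀ᶠ h in 𝓝[>] (0 : ℝ), ‖Y h a - X a‖ ≤ K * h) :
    Tendsto (fun h => h⁻¹ * ((∫ s in a..b, (φ (Y h s, v s (Y h s)) - φ (X s, v s (X s)))) +
      inner ℝ (p a (X a)) (Y h a - X a))) (𝓝[>] 0) (𝓝 0) := by
  set g : ℝ → E → ℝ := fun s x => φ (x, v s x) with hgdef
  set z : ℝ → ℝ → E := fun h s => Y h s - X s with hz
  have ham : a ∈ Icc a b := left_mem_Icc.2 hab
  have hbm : b ∈ Icc a b := right_mem_Icc.2 hab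
  -- The first order remainders of the running cost and of the field.
  set ρ : ℝ → ℝ → ℝ := fun h s =>
    (g s (Y h s) - g s (X s) - fderiv ℝ (g s) (X s) (z h s)) -
      inner ℝ (p s (X s)) (v s (Y h s) - v s (X s) - fderiv ℝ (v s) (X s) (z h s)) with hρ
  set K' : ℝ := |K| * Real.exp (L * |b - a|) with hK'
  have hK'0 : 0 ≤ K' := by positivity
  have hpos : ∀ᶠ h in 𝓝[>] (0 : ℝ), 0 < h := self_mem_nhdsWithin
  have hzle : ∀ᶠ h in 𝓝[>] (0 : ℝ), ∀ s ∈ Icc a b, ‖z h s‖ ≤ K' * h := by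
    filter_upwards [hY, hYK, hpos] with h h1 h2 h3 s hs
    refine (hv.norm_sub_le_mul_exp hX h1 hs ham).trans ?_
    have h4 : |s - a| ≤ |b - a| := by
      rw [abs_of_nonneg (sub_nonneg.2 hs.1), abs_of_nonneg (sub_nonneg.2 hab)]
      linarith [hs.2]
    calc ‖Y h a - X a‖ * Real.exp (L * |s - a|) ≤ (|K| * h) * Real.exp (L * |b - a|) := by
          gcongr
          exact h2.trans (by gcongr; exact le_abs_self K)
      _ = K' * h := by rw [hK']; ring
  -- Lipschitz path of the adjoint state.
  obtain ⟨MX, hMX⟩ := hv.exists_lipschitzOnWith hX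
  obtain ⟨Mp, hMp⟩ : ∃ Mp, LipschitzOnWith Mp (fun s => p s (X s)) (Icc a b) := by
    have h1 : LipschitzOnWith (max 1 MX) (fun s => (s, X s)) (Icc a b) :=
      (LipschitzWith.id.lipschitzOnWith).prodMk hMX
    have h2 : IsCompact ((fun s => (s, X s)) '' Icc a b) :=
      isCompact_Icc.image_of_continuousOn h1.continuousOn
    have h3 : (fun s => (s, X s)) '' Icc a b ⊆ Icc a b ×ˢ (univ : Set E) := by
      rintro _ ⟨s, hs, rfl⟩
      exact ⟨hs, mem_univ _⟩
    obtain ⟨Q, hQ⟩ := (hp.mono h3).exists_lipschitzOnWith_of_compact h2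
    exact ⟨_, hQ.comp h1 (mapsTo_image _ _)⟩
  obtain ⟨B, hB⟩ := isCompact_Icc.exists_bound_of_continuousOn hMp.continuousOn
  obtain ⟨R, hR⟩ := isCompact_Icc.exists_bound_of_continuousOn (s := Icc a b)
    hX.continuous.continuousOn
  obtain ⟨M, hM⟩ := hg (R + K' + 1)
  have hXd := hv.ae_hasDerivAt hX hab
  -- Integration of the product rule.
  have hkey : ∀ᶠ h in 𝓝[>] (0 : ℝ),
      IntervalIntegrable (ρ h) volume a b ∧
      (∫ s in a..b, (g s (Y h s) - g s (X s))) + inner ℝ (p a (X a)) (Y h a - X a) =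
        ∫ s in a..b, ρ h s := by
    filter_upwards [hY] with h hYh
    obtain ⟨MY, hMY⟩ := hv.exists_lipschitzOnWith hYh
    obtain ⟨Q, hQ⟩ := hMp.exists_lipschitzOnWith_inner (hMY.sub hMX)
    have hac : AbsolutelyContinuousOnInterval (fun s => inner ℝ (p s (X s)) (Y h s - X s)) a b := by
      apply LipschitzOnWith.absolutelyContinuousOnInterval (K := Q)
      rw [uIcc_of_le hab]
      exact hQ
    have hftc := hac.integral_deriv_eq_sub
    have hint := hac.intervalIntegrable_deriv
    have hgi : IntervalIntegrable (fun s => g s (Y h s) - g s (X s)) volume a b :=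
      (hv.intervalIntegrable_comp_continuous hφ hYh.continuous a b).sub
        (hv.intervalIntegrable_comp_continuous hφ hX.continuous a b)
    have hae : ∀ᵐ s ∂(volume.restrict (uIoc a b)), (g s (Y h s) - g s (X s)) -
        deriv (fun s => inner ℝ (p s (X s)) (Y h s - X s)) s = ρ h s := by
      rw [uIoc_of_le hab]
      refine ae_restrict_of_ae_restrict_of_subset Ioc_subset_Icc_self ?_
      filter_upwards [hXd, hv.ae_hasDerivAt hYh hab, hgood] with s h1 h2 h3
      have h4 := ((h3.hasDerivAt h1).inner ℝ (h2.sub h1)).deriv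
      have h5 : deriv (fun s => inner ℝ (p s (X s)) (Y h s - X s)) s = _ := h4
      rw [h5, hρ]
      simp only [Pi.sub_apply, inner_sub_left, inner_sub_right, ContinuousLinearMap.adjoint_inner_left,
        gradient, InnerProductSpace.toDual_symm_apply, hz, map_sub]
      ring
    refine ⟨(hgi.sub hint).congr_ae hae, ?_⟩
    rw [← intervalIntegral.integral_congr_ae_restrict hae, intervalIntegral.integral_sub hgi hint,
      hftc, hpb, inner_zero_left]
    ring
  -- Dominated convergence for the remainders.
  have hdct : Tendsto (fun h => ∫ s in a..b, h⁻¹ * ρ h s) (𝓝[>] 0) (𝓝 (∫ s in a..b, (0 : ℝ))) := by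
    have hsub : uIoc a b ⊆ Icc a b := by
      rw [uIoc_of_le hab]
      exact Ioc_subset_Icc_self
    have hgood' := (ae_restrict_iff' measurableSet_Icc).1 hgood
    have hM' := (ae_restrict_iff' measurableSet_Icc).1 hM
    refine intervalIntegral.tendsto_integral_filter_of_dominated_convergence
      (fun _ => (M * K' + M * K') + B * (L * K' + L * K')) ?_ ?_ ?_ ?_
    · filter_upwards [hkey] with h hh
      exact (intervalIntegrable_iff.1 (hh.1.const_mul _)).aestronglyMeasurable
    · have hlt1 : ∀ᶠ h in 𝓝[>] (0 : ℝ), h < 1 :=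
        mem_nhdsWithin_of_mem_nhds (Iio_mem_nhds zero_lt_one)
      filter_upwards [hzle, hpos, hlt1] with h hzh hh0 hh1
      filter_upwards [hgood', hM'] with s h1 h2 hs
      have hsI := hsub hs
      have hzs := hzh s hsI
      have hXs := hR s hsI
      have hzK : K' * h ≤ K' := mul_le_of_le_one_right hK'0 hh1.le
      have hXb : X s ∈ Metric.ball (0 : E) (R + K' + 1) := by
        rw [mem_ball_zero_iff]
        linarith
      have hYb : Y h s ∈ Metric.ball (0 : E) (R + K' + 1) := by
        rw [mem_ball_zero_iff]
        have := norm_le_norm_add_norm_sub' (Y h s) (X s)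
        have h3 : ‖Y h s - X s‖ ≤ K' * h := hzs
        linarith
      have e1 : ‖g s (Y h s) - g s (X s)‖ ≤ M * ‖z h s‖ := by
        simpa [dist_eq_norm] using (h2 hsI).dist_le_mul _ hYb _ hXb
      have e2 : ‖fderiv ℝ (g s) (X s) (z h s)‖ ≤ M * ‖z h s‖ :=
        (ContinuousLinearMap.le_opNorm _ _).trans (by
          gcongr
          exact norm_fderiv_le_of_lipschitzOn ℝ (Metric.isOpen_ball.mem_nhds hXb) (h2 hsI))
      have e3 : ‖v s (Y h s) - v s (X s)‖ ≤ L * ‖z h s‖ := (hv.lipschitz s).norm_sub_le _ _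
      have e4 : ‖fderiv ℝ (v s) (X s) (z h s)‖ ≤ L * ‖z h s‖ :=
        (ContinuousLinearMap.le_opNorm _ _).trans (by
          gcongr
          exact norm_fderiv_le_of_lipschitz ℝ (hv.lipschitz s))
      have e5 := hB s hsI
      have e6 : ‖ρ h s‖ ≤ (M * ‖z h s‖ + M * ‖z h s‖) + B * (L * ‖z h s‖ + L * ‖z h s‖) := by
        refine (norm_sub_le _ _).trans (add_le_add ((norm_sub_le _ _).trans (add_le_add e1 e2)) ?_)
        refine (norm_inner_le_norm _ _).trans (mul_le_mul e5
          ((norm_sub_le _ _).trans (add_le_add e3 e4)) (norm_nonneg _) ((norm_nonneg _).trans e5))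
      rw [norm_mul, norm_inv, Real.norm_of_nonneg hh0.le, inv_mul_le_iff₀ hh0]
      have hB0 : 0 ≤ B := (norm_nonneg _).trans e5
      calc ‖ρ h s‖ ≤ _ := e6
        _ ≤ (M * (K' * h) + M * (K' * h)) + B * (L * (K' * h) + L * (K' * h)) := by gcongr
        _ = _ := by ring
    · exact intervalIntegrable_const
    · filter_upwards [hgood'] with s h1 hs
      have hsI := hsub hs
      have hO : (fun h => z h s) =O[𝓝[>] 0] fun h : ℝ => h := by
        refine Asymptotics.IsBigO.of_bound K' ?_
        filter_upwards [hzle, hpos] with h h2 h3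
        rw [Real.norm_of_nonneg h3.le]
        exact h2 s hsI
      have hYs : Tendsto (fun h => Y h s) (𝓝[>] 0) (𝓝 (X s)) := by
        have h2 : Tendsto (fun h : ℝ => h) (𝓝[>] 0) (𝓝 0) := nhdsWithin_le_nhds
        have h3 : Tendsto (fun h => z h s) (𝓝[>] 0) (𝓝 0) := hO.trans_tendsto h2
        exact tendsto_sub_nhds_zero_iff.1 h3
      have o1 : (fun h => g s (Y h s) - g s (X s) - fderiv ℝ (g s) (X s) (z h s))
          =o[𝓝[>] 0] fun h : ℝ => h :=
        (((h1 hsI).differentiableAt_cost.hasFDerivAt.isLittleO).comp_tendsto hYs).trans_isBigO hO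
      have o2 : (fun h => v s (Y h s) - v s (X s) - fderiv ℝ (v s) (X s) (z h s))
          =o[𝓝[>] 0] fun h : ℝ => h :=
        (((h1 hsI).differentiableAt_field.hasFDerivAt.isLittleO).comp_tendsto hYs).trans_isBigO hO
      have o3 : (fun h => inner ℝ (p s (X s))
          (v s (Y h s) - v s (X s) - fderiv ℝ (v s) (X s) (z h s)))
          =o[𝓝[>] 0] fun h : ℝ => h :=
        ((innerSL ℝ (p s (X s))).isBigO_comp _ _).trans_isLittleO o2
      have h2 := (o1.sub o3).tendsto_div_nhds_zero
      refine h2.congr fun h => ?_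
      rw [hρ, div_eq_inv_mul]
  rw [intervalIntegral.integral_zero] at hdct
  refine hdct.congr' ?_
  filter_upwards [hkey] with h hh
  rw [intervalIntegral.integral_const_mul, hh.2]

/-! ### Needle variations and the minimum principle -/

/-- Feasibility controls the field on `[0, T]` only.  Its extension by zero is a Carathéodory field on
the whole line, with globally defined trajectories. -/
theorem IsFeasibleField.exists_isCaratheodoryField {N : ℕ} {T : ℝ}
    {u : ℝ → EuclideanSpace ℝ (Fin N) → EuclideanSpace ℝ (Fin N)} (hu : IsFeasibleField T u) :
    ∃ L C : ℝ≥0, IsCaratheodoryField L C ((Icc 0 T).indicator u) := by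
  obtain ⟨L, hL⟩ := hu.lipschitz
  obtain ⟨C, hC⟩ := hu.bounded_zero
  refine ⟨L, C.toNNReal, ?_, fun t => ?_, fun t => ?_⟩
  · have h : uncurry ((Icc 0 T).indicator u) = (Icc 0 T ×ˢ univ).indicator (uncurry u) := by
      ext1 z
      by_cases hz : z.1 ∈ Icc 0 T <;> simp [uncurry, indicator, hz]
    rw [h]
    exact hu.measurable.indicator (measurableSet_Icc.prod MeasurableSet.univ)
  · by_cases ht : t ∈ Icc 0 T
    · rw [indicator_of_mem ht]
      exact hL t ht
    · rw [indicator_of_notMem ht]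
      exact (LipschitzWith.const' 0).weaken bot_le
  · by_cases ht : t ∈ Icc 0 T
    · rw [indicator_of_mem ht]
      exact (hC t ht).trans (Real.le_coe_toNNReal C)
    · rw [indicator_of_notMem ht]
      simp

theorem IsFeasibleField.isIntegralCurveFrom {N : ℕ} {T : ℝ} (hT : 0 ≤ T)
    {u : ℝ → EuclideanSpace ℝ (Fin N) → EuclideanSpace ℝ (Fin N)} (hu : IsFeasibleField T u)
    {X : ℝ → EuclideanSpace ℝ (Fin N)}
    (hX : IsMildSolutionOn ((Icc 0 T).indicator u) (Icc 0 T) X) :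
    IsIntegralCurveFrom T u (X 0) X := by
  obtain ⟨L, C, hv⟩ := hu.exists_isCaratheodoryField
  obtain ⟨M, hM⟩ := hv.exists_lipschitzOnWith hX
  refine ⟨LipschitzOnWith.absolutelyContinuousOnInterval (K := M) (by rwa [uIcc_of_le hT]), rfl, ?_⟩
  filter_upwards [hv.ae_hasDerivAt hX hT, ae_restrict_mem measurableSet_Icc] with t ht htI
  rwa [indicator_of_mem htI] at ht

theorem IsIntegralCurveFrom.pathCost_eq {N : ℕ} {T : ℝ} (hT : 0 ≤ T)
    {φ : EuclideanSpace ℝ (Fin N) × EuclideanSpace ℝ (Fin N) → ℝ}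
    {u : ℝ → EuclideanSpace ℝ (Fin N) → EuclideanSpace ℝ (Fin N)}
    {x₀ : EuclideanSpace ℝ (Fin N)} {X : ℝ → EuclideanSpace ℝ (Fin N)}
    (hX : IsIntegralCurveFrom T u x₀ X) :
    pathCost T φ X = ∫ s in (0 : ℝ)..T, φ (X s, (Icc 0 T).indicator u s (X s)) := by
  refine intervalIntegral.integral_congr_ae ?_
  filter_upwards [(ae_restrict_iff' measurableSet_Icc).1 hX.hasDerivAt] with s hs hsI
  rw [uIoc_of_le hT] at hsI
  have hsI' := Ioc_subset_Icc_self hsI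
  rw [(hs hsI').deriv, indicator_of_mem hsI']

/-- The field `u`, replaced by the constant velocity `w` at times in `(a, b)`. -/
noncomputable def needleField {E : Type*} (a b : ℝ) (w : E) (u : ℝ → E → E) : ℝ → E → E :=
  fun t x => (Ioo a b).piecewise (fun _ => w) (fun t => u t x) t

theorem needleField_of_mem {E : Type*} {a b t : ℝ} (h : t ∈ Ioo a b) (w : E) (u : ℝ → E → E) :
    needleField a b w u t = fun _ => w := by
  ext1 x
  exact piecewise_eq_of_mem _ _ _ h

theorem needleField_of_notMem {E : Type*} {a b t : ℝ} (h : t ∉ Ioo a b) (w : E)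
    (u : ℝ → E → E) : needleField a b w u t = u t := by
  ext1 x
  exact piecewise_eq_of_notMem _ _ _ h

theorem IsFeasibleField.needleField {N : ℕ} {T : ℝ}
    {u : ℝ → EuclideanSpace ℝ (Fin N) → EuclideanSpace ℝ (Fin N)} (hu : IsFeasibleField T u)
    (a b : ℝ) (w : EuclideanSpace ℝ (Fin N)) : IsFeasibleField T (needleField a b w u) := by
  obtain ⟨L, hL⟩ := hu.lipschitz
  obtain ⟨C, hC⟩ := hu.bounded_zero
  refine ⟨?_, ⟨L, fun t ht => ?_⟩, ⟨max ‖w‖ C, fun t ht => ?_⟩⟩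
  · have h : Measurable ((Ioo a b ×ˢ univ).piecewise (fun _ => w) (uncurry u)) :=
      measurable_const.piecewise (measurableSet_Ioo.prod MeasurableSet.univ) hu.measurable
    convert h using 1
    ext1 z
    by_cases hz : z.1 ∈ Ioo a b
    · rw [piecewise_eq_of_mem _ _ _ (show z ∈ Ioo a b ×ˢ univ from ⟨hz, mem_univ _⟩), uncurry,
        needleField_of_mem hz]
    · rw [piecewise_eq_of_notMem _ _ _ (show z ∉ Ioo a b ×ˢ univ from fun h => hz h.1), uncurry,
        needleField_of_notMem hz, uncurry]
  · by_cases h : t ∈ Ioo a b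
    · rw [needleField_of_mem h]
      exact (LipschitzWith.const w).weaken bot_le
    · rw [needleField_of_notMem h]
      exact hL t ht
  · by_cases h : t ∈ Ioo a b
    · rw [needleField_of_mem h]
      exact le_max_left _ _
    · rw [needleField_of_notMem h]
      exact (hC t ht).trans (le_max_right _ _)

theorem intervalIntegral_congr_Ioo {E : Type*} [NormedAddCommGroup E] [NormedSpace ℝ E]
    {f g : ℝ → E} {a b : ℝ} (hab : a ≤ b) (h : EqOn f g (Ioo a b)) :
    ∫ s in a..b, f s = ∫ s in a..b, g s := by
  rw [intervalIntegral.integral_of_le hab, intervalIntegral.integral_of_le hab,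
    integral_Ioc_eq_integral_Ioo, integral_Ioc_eq_integral_Ioo]
  exact setIntegral_congr_fun measurableSet_Ioo h

open Filter Topology in
/-- The mean cost of the short segments of velocity `w` that end at time `t`. -/
theorem tendsto_inv_mul_integral_affine {E : Type*} [NormedAddCommGroup E] [NormedSpace ℝ E]
    {ψ : E → ℝ} (hψ : Continuous ψ) {X : ℝ → E} (hX : Continuous X) (t : ℝ) (w : E) :
    Tendsto (fun h : ℝ => h⁻¹ * ∫ s in (t - h)..t, ψ (X (t - h) + (s - (t - h)) • w))
      (𝓝[>] 0) (𝓝 (ψ (X t))) := by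
  have hc : Continuous fun h : ℝ => ∫ θ in (0 : ℝ)..1, ψ (X (t - h) + (h * θ) • w) :=
    intervalIntegral.continuous_parametric_intervalIntegral_of_continuous' (by fun_prop) 0 1
  have h0 : Tendsto (fun h : ℝ => ∫ θ in (0 : ℝ)..1, ψ (X (t - h) + (h * θ) • w)) (𝓝[>] 0)
      (𝓝 (ψ (X t))) := by
    have := (hc.tendsto 0).mono_left (nhdsWithin_le_nhds (s := Ioi 0))
    simpa using this
  refine h0.congr' ?_
  filter_upwards [self_mem_nhdsWithin] with h hh
  have hh0 : h ≠ 0 := ne_of_gt hh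
  have := intervalIntegral.mul_integral_comp_add_mul (a := 0) (b := 1)
    (f := fun s => ψ (X (t - h) + (s - (t - h)) • w)) h (t - h)
  simp only [mul_zero, add_zero, mul_one, sub_add_cancel, add_sub_cancel_left] at this
  rw [← this, inv_mul_cancel_left₀ hh0]

open Filter Topology in
/-- Pontryagin's minimum principle along a trajectory of an optimal field, at a time `t` at which the
trajectory and its accumulated cost are differentiable.  On the short interval `[t - h, t]` the field
is replaced by the constant velocity `w`; afterwards the perturbed path is again driven by `u`, and
the change of its cost is given to first order by `p`. -/
theorem IsOptimalField.le_sub_inner {N : ℕ} {T : ℝ}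
    {φ : EuclideanSpace ℝ (Fin N) × EuclideanSpace ℝ (Fin N) → ℝ} (hφ : Differentiable ℝ φ)
    {u p : ℝ → EuclideanSpace ℝ (Fin N) → EuclideanSpace ℝ (Fin N)} (hu : IsOptimalField T φ u)
    (hp : IsTransportSolution T φ u p) {X : ℝ → EuclideanSpace ℝ (Fin N)}
    (hX : IsMildSolutionOn ((Icc 0 T).indicator u) univ X)
    (hgood : ∀ᵐ s ∂(volume.restrict (Icc 0 T)), IsTransportAt ((Icc 0 T).indicator u) p
      (fun s x => φ (x, (Icc 0 T).indicator u s x)) X s)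
    {t : ℝ} (ht : t ∈ Ioo 0 T) (htX : HasDerivAt X (u t (X t)) t)
    (htφ : HasDerivAt (fun τ => ∫ s in (0 : ℝ)..τ, φ (X s, (Icc 0 T).indicator u s (X s)))
      (φ (X t, u t (X t))) t) (w : EuclideanSpace ℝ (Fin N)) :
    φ (X t, u t (X t)) - inner ℝ (p t (X t)) (u t (X t)) ≤ φ (X t, w) - inner ℝ (p t (X t)) w := by
  have hT : 0 ≤ T := (ht.1.trans ht.2).le
  set v := (Icc 0 T).indicator u with hvdef
  obtain ⟨L, C, hv⟩ := hu.feasible.exists_isCaratheodoryField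
  have hφc := hφ.continuous
  -- The perturbed fields and their trajectories.
  set vh : ℝ → ℝ → EuclideanSpace ℝ (Fin N) → EuclideanSpace ℝ (Fin N) :=
    fun h => (Icc 0 T).indicator (needleField (t - h) t w u) with hvh
  have hfeas : ∀ h, IsFeasibleField T (needleField (t - h) t w u) := fun h =>
    hu.feasible.needleField _ _ _
  have hexY : ∀ h, ∃ Y, IsMildSolutionOn (vh h) univ Y ∧ Y 0 = X 0 := fun h => by
    obtain ⟨L', C', hv'⟩ := (hfeas h).exists_isCaratheodoryField
    exact hv'.exists_isMildSolutionOn 0 (X 0)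
  choose Y hY hY0 using hexY
  have hvh_out : ∀ h r, r ∉ Ioo (t - h) t → vh h r = v r := fun h r hr => by
    by_cases hrI : r ∈ Icc 0 T
    · simp only [hvh, hvdef, indicator_of_mem hrI, needleField_of_notMem hr]
    · simp only [hvh, hvdef, indicator_of_notMem hrI]
  have hsmall : ∀ᶠ h in 𝓝[>] (0 : ℝ), h ∈ Ioo 0 t := Ioo_mem_nhdsGT ht.1
  have hvh_in : ∀ h ∈ Ioo 0 t, ∀ r ∈ Ioo (t - h) t, vh h r = fun _ => w := fun h hh r hr => by
    have hrI : r ∈ Icc 0 T := ⟨by linarith [hr.1, hh.2], by linarith [hr.2, ht.2]⟩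
    simp only [hvh, indicator_of_mem hrI, needleField_of_mem hr]
  have hYbefore : ∀ h ∈ Ioo 0 t, ∀ s ∈ Icc 0 (t - h), Y h s = X s := fun h hh s hs => by
    have h1 : IsMildSolutionOn v (Icc 0 (t - h)) (Y h) :=
      ((hY h).mono (subset_univ _)).congr_field fun r hr => hvh_out h r fun hr' =>
        absurd hr.2 (not_lt.2 hr'.1.le)
    exact hv.eq_of_eq (hX.mono (subset_univ _)) h1 hs ⟨le_rfl, by linarith [hh.2]⟩ (hY0 h)
  have hYneedle : ∀ h ∈ Ioo 0 t, ∀ s ∈ Icc (t - h) t,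
      Y h s = X (t - h) + (s - (t - h)) • w := fun h hh s hs => by
    have h1 : IsMildSolutionOn (fun _ _ => w) (Icc (t - h) t) (Y h) :=
      ((hY h).mono (subset_univ _)).congr_field (hvh_in h hh)
    have h2 := h1.sub_eq (t - h) ⟨le_rfl, by linarith [hh.1]⟩ s hs
    rw [intervalIntegral.integral_const, sub_eq_iff_eq_add,
      hYbefore h hh (t - h) ⟨by linarith [hh.2], le_rfl⟩] at h2
    rw [h2, add_comm]
  have hYafter : ∀ h, IsMildSolutionOn v (Icc t T) (Y h) := fun h =>
    ((hY h).mono (subset_univ _)).congr_field fun r hr => hvh_out h r fun hr' =>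
      absurd hr.1 (not_lt.2 hr'.2.le)
  -- Comparison of the costs.
  have hcost : ∀ h ∈ Ioo 0 t, ∫ s in (t - h)..t, φ (X s, v s (X s)) ≤
      (∫ s in (t - h)..t, φ (X (t - h) + (s - (t - h)) • w, w)) +
        ∫ s in t..T, (φ (Y h s, v s (Y h s)) - φ (X s, v s (X s))) := fun h hh => by
    obtain ⟨L', C', hv'⟩ := (hfeas h).exists_isCaratheodoryField
    have hcX := hu.feasible.isIntegralCurveFrom hT (hX.mono (subset_univ _))
    have hcY := (hfeas h).isIntegralCurveFrom hT ((hY h).mono (subset_univ _))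
    rw [hY0 h] at hcY
    have hle := hu.le_cost _ (hfeas h) (X 0) X (Y h) hcX hcY
    rw [hcX.pathCost_eq hT, hcY.pathCost_eq hT] at hle
    have hiX : ∀ a b, IntervalIntegrable (fun s => φ (X s, v s (X s))) volume a b :=
      hv.intervalIntegrable_comp_continuous hφc hX.continuous
    have hiY : ∀ a b, IntervalIntegrable (fun s => φ (Y h s, vh h s (Y h s))) volume a b :=
      hv'.intervalIntegrable_comp_continuous hφc (hY h).continuous
    have hiYv : ∀ a b, IntervalIntegrable (fun s => φ (Y h s, v s (Y h s))) volume a b :=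
      hv.intervalIntegrable_comp_continuous hφc (hY h).continuous
    have e1 : ∫ s in (0 : ℝ)..(t - h), φ (Y h s, vh h s (Y h s)) =
        ∫ s in (0 : ℝ)..(t - h), φ (X s, v s (X s)) := by
      refine intervalIntegral_congr_Ioo (by linarith [hh.2]) fun s hs => ?_
      have h1 : s ∉ Ioo (t - h) t := fun h' => absurd hs.2 (not_lt.2 h'.1.le)
      simp only [hvh_out h s h1, hYbefore h hh s (Ioo_subset_Icc_self hs)]
    have e2 : ∫ s in (t - h)..t, φ (Y h s, vh h s (Y h s)) =
        ∫ s in (t - h)..t, φ (X (t - h) + (s - (t - h)) • w, w) := by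
      refine intervalIntegral_congr_Ioo (by linarith [hh.1]) fun s hs => ?_
      simp only [hvh_in h hh s hs, hYneedle h hh s (Ioo_subset_Icc_self hs)]
    have e3 : ∫ s in t..T, φ (Y h s, vh h s (Y h s)) = ∫ s in t..T, φ (Y h s, v s (Y h s)) := by
      refine intervalIntegral_congr_Ioo ht.2.le fun s hs => ?_
      have h1 : s ∉ Ioo (t - h) t := fun h' => absurd hs.1 (not_lt.2 h'.2.le)
      simp only [hvh_out h s h1]
    have s1 := intervalIntegral.integral_add_adjacent_intervals (hiX 0 (t - h)) (hiX (t - h) t)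
    have s2 := intervalIntegral.integral_add_adjacent_intervals (hiX 0 t) (hiX t T)
    have s3 := intervalIntegral.integral_add_adjacent_intervals (hiY 0 (t - h)) (hiY (t - h) t)
    have s4 := intervalIntegral.integral_add_adjacent_intervals (hiY 0 t) (hiY t T)
    rw [intervalIntegral.integral_sub (hiYv t T) (hiX t T)]
    have hle' : ∫ s in (0 : ℝ)..T, φ (X s, v s (X s)) ≤
      ∫ s in (0 : ℝ)..T, φ (Y h s, vh h s (Y h s)) := hle
    linarith
  -- The state at time `t` moves with velocity `w - u` in the parameter `h`.
  have hz : Tendsto (fun h : ℝ => h⁻¹ • (Y h t - X t)) (𝓝[>] 0) (𝓝 (w - u t (X t))) := by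
    have h1 : HasDerivAt (fun h : ℝ => X (t - h) + h • w) (w - u t (X t)) 0 := by
      have h2 : HasDerivAt (fun h : ℝ => X (t - h)) (-u t (X t)) 0 := by
        have h3 : HasDerivAt X (u t (X t)) (t - 0) := by rwa [sub_zero]
        exact h3.comp_const_sub t 0
      have h4 : HasDerivAt (fun h : ℝ => h • w) ((1 : ℝ) • w) 0 :=
        (hasDerivAt_id (0 : ℝ)).smul_const w
      refine (h2.add h4).congr_deriv ?_
      rw [one_smul]
      abel
    refine h1.tendsto_slope_zero_right.congr' ?_
    filter_upwards [hsmall] with h hh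
    rw [hYneedle h hh t ⟨by linarith [hh.1], le_rfl⟩]
    simp
  have hzK : ∀ᶠ h in 𝓝[>] (0 : ℝ), ‖Y h t - X t‖ ≤ (‖w - u t (X t)‖ + 1) * h := by
    filter_upwards [hz.norm.eventually_le_const (lt_add_one _), hsmall] with h h1 h2
    rwa [norm_smul, norm_inv, Real.norm_of_nonneg h2.1.le, inv_mul_le_iff₀ h2.1, mul_comm] at h1
  -- Passage to the limit.
  have hsub : Icc t T ⊆ Icc 0 T := Icc_subset_Icc_left ht.1.le
  have lim3 := hv.tendsto_cost_sub_add_inner hφc ht.2.le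
    (hp.locallyLipschitz.mono (prod_mono_left hsub)) hp.terminal
    (fun R => by
      obtain ⟨M, hM⟩ := hp.exists_lipschitzOnWith hφ hu.feasible R
      refine ⟨M, ae_restrict_of_ae_restrict_of_subset hsub ?_⟩
      filter_upwards [hM, ae_restrict_mem measurableSet_Icc] with s hs hsI
      rwa [indicator_of_mem hsI])
    (hX.mono (subset_univ _)) (ae_restrict_of_ae_restrict_of_subset hsub hgood)
    (Eventually.of_forall hYafter) hzK
  have lim1 : Tendsto (fun h : ℝ => h⁻¹ * ∫ s in (t - h)..t, φ (X s, v s (X s))) (𝓝[>] 0)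
      (𝓝 (φ (X t, u t (X t)))) := by
    have hiX : ∀ a b, IntervalIntegrable (fun s => φ (X s, v s (X s))) volume a b :=
      hv.intervalIntegrable_comp_continuous hφc hX.continuous
    have h1 : HasDerivAt (fun h : ℝ => -∫ s in (0 : ℝ)..(t - h), φ (X s, v s (X s)))
        (φ (X t, u t (X t))) 0 := by
      have h3 : HasDerivAt (fun τ => ∫ s in (0 : ℝ)..τ, φ (X s, v s (X s)))
        (φ (X t, u t (X t))) (t - 0) := by rwa [sub_zero]
      exact (h3.comp_const_sub t 0).neg.congr_deriv (neg_neg _)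
    refine h1.tendsto_slope_zero_right.congr fun h => ?_
    rw [← intervalIntegral.integral_interval_sub_left (hiX 0 t) (hiX 0 (t - h))]
    simp only [zero_add, sub_zero, smul_eq_mul]
    ring
  have lim2 := tendsto_inv_mul_integral_affine (ψ := fun x => φ (x, w)) (by fun_prop)
    hX.continuous t w
  have lim4 : Tendsto (fun h : ℝ => h⁻¹ * inner ℝ (p t (X t)) (Y h t - X t)) (𝓝[>] 0)
      (𝓝 (inner ℝ (p t (X t)) (w - u t (X t)))) := by
    refine (((innerSL ℝ (p t (X t))).continuous.tendsto _).comp hz).congr fun h => ?_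
    simp [inner_smul_right]
  have hfinal := le_of_tendsto_of_tendsto lim1 ((lim2.add lim3).sub lim4) (by
    filter_upwards [hsmall] with h hh
    have h1 := mul_le_mul_of_nonneg_left (hcost h hh) (inv_nonneg.2 hh.1.le)
    refine h1.trans (le_of_eq ?_)
    ring)
  rw [inner_sub_right] at hfinal
  linarith

/-- Fermat's rule for `w ↦ ψ w - ⟪q, w⟫`. -/
theorem gradient_eq_of_forall_sub_inner_le {E : Type*} [NormedAddCommGroup E]
    [InnerProductSpace ℝ E] [CompleteSpace E] {ψ : E → ℝ} {q ξ : E} (hψ : DifferentiableAt ℝ ψ ξ)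
    (h : ∀ w, ψ ξ - inner ℝ q ξ ≤ ψ w - inner ℝ q w) : gradient ψ ξ = q := by
  have hmin : IsLocalMin (fun w => ψ w - innerSL ℝ q w) ξ := Filter.Eventually.of_forall h
  have h1 := hmin.hasFDerivAt_eq_zero (hψ.hasFDerivAt.sub (innerSL ℝ q).hasFDerivAt)
  rw [gradient, sub_eq_zero.1 h1]
  exact (InnerProductSpace.toDual ℝ E).symm_apply_apply q

open Filter in
/-- Pontryagin's minimum principle in feedback form.  Along the trajectories of a dense set of initial
points it follows from the needle variation; it passes to all points because the inequality, unlike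
the equation for the gradient, is closed, and because the flow maps are onto. -/
theorem IsOptimalField.ae_forall_le_sub_inner {N : ℕ} {T : ℝ} (hT : 0 ≤ T)
    {φ : EuclideanSpace ℝ (Fin N) × EuclideanSpace ℝ (Fin N) → ℝ} (hφ : Differentiable ℝ φ)
    {u p : ℝ → EuclideanSpace ℝ (Fin N) → EuclideanSpace ℝ (Fin N)} (hu : IsOptimalField T φ u)
    (hp : IsTransportSolution T φ u p) :
    ∀ᵐ t ∂(volume.restrict (Icc 0 T)), ∀ x w : EuclideanSpace ℝ (Fin N),
      φ (x, u t x) - inner ℝ (p t x) (u t x) ≤ φ (x, w) - inner ℝ (p t x) w := by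
  obtain ⟨L, C, hv⟩ := hu.feasible.exists_isCaratheodoryField
  have hφc := hφ.continuous
  choose X hX hX0 using fun x => hv.exists_isMildSolutionOn 0 x
  have hgood : ∀ᵐ x : EuclideanSpace ℝ (Fin N), ∀ᵐ s ∂(volume.restrict (Icc 0 T)),
      IsTransportAt ((Icc 0 T).indicator u) p
        (fun s x => φ (x, (Icc 0 T).indicator u s x)) (X x) s := by
    have heq := (ae_restrict_iff' (measurableSet_Icc.prod MeasurableSet.univ)).1 hp.equation
    rw [Measure.volume_eq_prod] at heq
    filter_upwards [hv.ae_ae_flow hX hX0 heq] with x hx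
    rw [ae_restrict_iff' measurableSet_Icc]
    filter_upwards [hx] with s hs hsI
    obtain ⟨h1, h2, h3⟩ := hs ⟨hsI, mem_univ _⟩
    refine ⟨h1, ?_, ?_, ?_⟩
    · rw [indicator_of_mem hsI]
      exact h2
    · simp only [indicator_of_mem hsI]
      exact (hφ _).comp _ (differentiableAt_id.prodMk h2)
    · simp only [indicator_of_mem hsI]
      exact h3
  obtain ⟨D, hDsub, hDc, hD⟩ := (Measure.dense_of_ae hgood).exists_countable_dense_subset
  have hall : ∀ᵐ t ∂(volume.restrict (Icc 0 T)), ∀ x ∈ D, ∀ w : EuclideanSpace ℝ (Fin N),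
      φ (X x t, u t (X x t)) - inner ℝ (p t (X x t)) (u t (X x t)) ≤
        φ (X x t, w) - inner ℝ (p t (X x t)) w := by
    refine (ae_ball_iff hDc).2 fun x hx => ?_
    have hint := hv.intervalIntegrable_comp_continuous hφc (hX x).continuous 0 T
    have h1 := hv.ae_hasDerivAt ((hX x).mono (subset_univ (Icc 0 T))) hT
    rw [ae_restrict_iff' measurableSet_Icc] at h1 ⊢
    have ha : ∀ᵐ r : ℝ, r ≠ 0 := by simp [ae_iff, measure_singleton]
    have hb : ∀ᵐ r : ℝ, r ≠ T := by simp [ae_iff, measure_singleton]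
    filter_upwards [h1, hint.ae_hasDerivAt_integral, ha, hb] with t h2 h3 ht0 htT htI w
    have h4 := h3 (by rwa [uIcc_of_le hT]) 0 left_mem_uIcc
    have h5 := h2 htI
    simp only [indicator_of_mem htI] at h5
    have h6 : φ (X x t, (Icc 0 T).indicator u t (X x t)) = φ (X x t, u t (X x t)) := by
      rw [indicator_of_mem htI]
    rw [h6] at h4
    exact hu.le_sub_inner hφ hp (hX x) (hDsub hx)
      ⟨lt_of_le_of_ne htI.1 ht0.symm, lt_of_le_of_ne htI.2 htT⟩ h5 h4 w
  obtain ⟨Lu, hLu⟩ := hu.feasible.lipschitz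
  filter_upwards [hall, ae_restrict_mem measurableSet_Icc] with t ht htI x w
  have huc : Continuous (u t) := (hLu t htI).continuous
  have hpc : Continuous (p t) :=
    hp.locallyLipschitz.continuousOn.comp_continuous (f := fun y => (t, y)) (by fun_prop)
      fun y => ⟨htI, mem_univ _⟩
  have hdense : Dense ((fun x => X x t) '' D) :=
    (hv.surjective_flow hX hX0 t).denseRange.dense_image
      (hv.lipschitzWith_flow hX hX0 t).continuous hD
  have hclosed : IsClosed {y | φ (y, u t y) - inner ℝ (p t y) (u t y) ≤
      φ (y, w) - inner ℝ (p t y) w} := isClosed_le (by fun_prop) (by fun_prop)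
  have hsub : (fun x => X x t) '' D ⊆ {y | φ (y, u t y) - inner ℝ (p t y) (u t y) ≤
      φ (y, w) - inner ℝ (p t y) w} := by
    rintro _ ⟨y, hy, rfl⟩
    exact ht y hy w
  exact hclosed.closure_subset_iff.2 hsub (hdense x)

theorem mainTheorem8 (N : ℕ) (T : ℝ) (hT : 0 < T)
    (φ : EuclideanSpace ℝ (Fin N) × EuclideanSpace ℝ (Fin N) → ℝ)
    (hφ : Differentiable ℝ φ)
    (u : ℝ → EuclideanSpace ℝ (Fin N) → EuclideanSpace ℝ (Fin N))
    (hu : IsOptimalField T φ u)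
    (p : ℝ → EuclideanSpace ℝ (Fin N) → EuclideanSpace ℝ (Fin N))
    (hp : IsTransportSolution T φ u p) :
    (∀ᵐ t ∂(volume.restrict (Icc 0 T)), ∀ x : EuclideanSpace ℝ (Fin N),
      p t x = gradient (fun ξ => φ (x, ξ)) (u t x)) ∧
    (ContinuousOn (uncurry u) (Icc 0 T ×ˢ univ) →
      ∀ t ∈ Icc 0 T, ∀ x : EuclideanSpace ℝ (Fin N),
        p t x = gradient (fun ξ => φ (x, ξ)) (u t x)) := by
  have hmin := hu.ae_forall_le_sub_inner hT.le hφ hp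
  have hdiff : ∀ x ξ : EuclideanSpace ℝ (Fin N), DifferentiableAt ℝ (fun ξ => φ (x, ξ)) ξ :=
    fun x ξ => (hφ (x, ξ)).comp ξ ((differentiableAt_const x).prodMk differentiableAt_id)
  have hφc := hφ.continuous
  refine ⟨?_, fun huc t ht x => ?_⟩
  · filter_upwards [hmin] with t ht x
    exact (gradient_eq_of_forall_sub_inner_le (hdiff x _) (ht x)).symm
  · refine (gradient_eq_of_forall_sub_inner_le (hdiff x _) fun w => ?_).symm
    have hmaps : MapsTo (fun s => (s, x)) (Icc 0 T) (Icc 0 T ×ˢ univ) :=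
      fun s hs => ⟨hs, mem_univ x⟩
    have hux : ContinuousOn (fun s => u s x) (Icc 0 T) := huc.comp (by fun_prop) hmaps
    have hpx : ContinuousOn (fun s => p s x) (Icc 0 T) :=
      hp.locallyLipschitz.continuousOn.comp (by fun_prop) hmaps
    set d : ℝ → ℝ := fun s => (φ (x, w) - inner ℝ (p s x) w) -
      (φ (x, u s x) - inner ℝ (p s x) (u s x)) with hd
    have hdc : ContinuousOn d (Icc 0 T) :=
      (continuousOn_const.sub (hpx.inner continuousOn_const)).sub
        ((hφc.comp_continuousOn (continuousOn_const.prodMk hux)).sub (hpx.inner hux))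
    -- A continuous function that is nonnegative almost everywhere is nonnegative.
    have h0 : d =ᵐ[volume.restrict (Icc 0 T)] fun s => |d s| := by
      filter_upwards [hmin] with s hs
      exact (abs_of_nonneg (sub_nonneg.2 (hs x w))).symm
    have h1 : d t = |d t| := Measure.eqOn_Icc_of_ae_eq volume hT.ne h0 hdc hdc.abs ht
    have h2 : 0 ≤ d t := h1 ▸ abs_nonneg _
    exact sub_nonneg.1 h2
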